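/- **Game.** There are $N\ge1$ clusters, cluster $i$ having $n_i\ge 1$ agents; $n=\sum_i n_i$. Agent $j$ of cluster $i$ has decision $x^i_j\in\mathbb R$ and local cost $J^i_j:\mathbb R^n\to\mathbb R$; $\mathbf x^i=(x^i_1,\dots,x^i_{n_i})$, $\mathbf x=(\mathbf x^1,\dots,\mathbf x^N)$, and $J^i=\frac1{n_i}\sum_{j}J^i_j$. A Nash equilibrium (NE) is a point $\mathbf x^*$ with $J^i(\mathbf x^{*})\le J^i(\mathbf x^i,\mathbf x^{-i*})$ for all $i$ and all $\mathbf x^i\in\mathbb R^{n_i}$. Assume: 1. Each $A^i=[a^i_{jk}]\in\mathbb R^{n_i\times n_i}$ is a nonnegative, column-stochastic adjacency matrix (with $a^i_{jk}>0$ iff $k\to j$ is an edge) of a strongly connected digraph with all self-loops. 2. $\bar A=[\bar a_{pq}]\in\mathbb R^{n\times n}$ is a nonnegative, row-stochastic adjacency matrix of a strongly connected digraph with all self-loops on the set $\bar{\mathcal V}$ of all $n$ agents. 3. Each $J^i_j$ is convex and continuously differentiable in $\mathbf x^i$, jointly continuous in $\mathbf x$, and every $\nabla_{x^i_k}J^i_j$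 ($1\le k\le n_i$) is $\mathcal L$-Lipschitz on $\mathbb R^n$. 4. $\mathbf F(\mathbf x)=(\nabla_{\mathbf x^i}J^i(\mathbf x))_{i}$ is strongly monotone with constant $\chi>0$. 5. $\delta_p>0$ and $\delta_p\bar a_{pq}<2\bar a_{pp}$ for all $p,q\in\bar{\mathcal V}$. **Algorithm** with uniform step-size $\gamma>0$. Identify each $q\in\bar{\mathcal V}$ with a pair $(i,j)$ and write $\mathsf y_q=x^i_j$. From arbitrary $x^i_{j,0}$, $\mathbf y^p_0\in\mathbb R^n$ and with $g^i_{jk,0}=\nabla_{x^i_k}J^i_j(\mathbf y^{(i,j)}_0)$, iterate $$y^p_{q,t+1}=\sum_{l}\bar a_{pl}y^l_{q,t}+\delta_p\bar a_{pq}(\mathsf y_{q,t}-y^p_{q,t}),\qquad x^i_{j,t+1}=x^i_{j,t}-\gamma g^i_{jj,t},$$ $$g^i_{jk,t+1}=\sum_{l}a^i_{jl}g^i_{lk,t}+\nabla_{x^i_k}J^i_j(\mathbf y^{(i,j)}_{t+1})-\nabla_{x^i_k}J^i_j(\mathbf y^{(i,j)}_t).$$ **Notation.** $\pi^i$ is the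 vector with $A^i\pi^i=\pi^i$, $\mathbf 1^\top\pi^i=1$; $\iota=\max_i\|\pi^i\|_2$; $\boldsymbol\pi^i=n_i\pi^i$, $\boldsymbol\pi=(\boldsymbol\pi^1,\dots,\boldsymbol\pi^N)$ with smallest and largest entries $\underline{\boldsymbol\pi},\overline{\boldsymbol\pi}$; $A^i_\infty=\lim_k (A^i)^k$; $\|u\|_w=\|\mathrm{diag}(\sqrt w)^{-1}u\|_2$ and $\|B\|_w=\|\mathrm{diag}(\sqrt w)^{-1}B\,\mathrm{diag}(\sqrt w)\|_2$ (spectral norm) for a positive vector $w$. $\tilde A_q$ is $\bar A$ with its diagonal entries replaced by $|\bar a_{pp}-\delta_p\bar a_{pq}|$. An admissible pair of norms is a matrix norm $\|\cdot\|_E$ and a vector norm $\|\cdot\|_e$ on $\mathbb R^n$ with $\|Bv\|_e\le\|B\|_E\|v\|_e$ and $\|\tilde A_q\|_E<1$ for all $q\in\bar{\mathcal V}$; for it, $\underline C,\overline C>0$ are constants with $\underline C\|v\|_2\le\|v\|_e\le\overline C\|v\|_2$ for all $v$. Put $\sigma_{A^i}=\|A^i-A^i_\infty\|_{\boldsymbol\pi^i}$,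 $\sigma_{\tilde A_q}=\|\tilde A_q\|_E$, $\bar\sigma_1=\max_i\sigma_{A^i}$, $\bar\sigma_2=\max_q\sigma_{\tilde A_q}$, $\varsigma_1=\max_i\frac{1+\sigma_{A^i}^2}{1-\sigma_{A^i}^2}$, $\varsigma_2=\max_q\frac{1+\sigma_{\tilde A_q}^2}{1-\sigma_{\tilde A_q}^2}$, $S=\sum_i n_i^3$, $\omega=1+n\varsigma_2\overline C^2$, and $$k_1=\underline{\boldsymbol\pi}\chi,\; k_2=\tfrac{3\overline{\boldsymbol\pi}\iota^2\mathcal L^2}{\underline{\boldsymbol\pi}}S,\; k_4=\tfrac{3\overline{\boldsymbol\pi}}{\underline{\boldsymbol\pi}},\; k_5=\tfrac{3}{\underline{\boldsymbol\pi}\chi},\; k_6=\tfrac{3n^2\iota^2\mathcal L^2}{\underline{\boldsymbol\pi}\,\underline C^2},\; k_7=\tfrac{3\overline{\boldsymbol\pi}n\mathcal L^2}{\underline{\boldsymbol\pi}\,\underline C^2\chi},$$ $$k_8=\tfrac{9\overline{\boldsymbol\pi}n^2\varsigma_1\omega\iota^2\mathcal L^4}{\underline{\boldsymbol\pi}}S,\;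 k_9=\tfrac{9\overline{\boldsymbol\pi}n^2\varsigma_1\omega\mathcal L^2}{\underline{\boldsymbol\pi}}S,\; k_{10}=\tfrac{1-\bar\sigma_1^2}2,\; k_{11}=\tfrac{3n\varsigma_1(3+\bar\sigma_2^2)\mathcal L^2}{2\underline{\boldsymbol\pi}\,\underline C^2},\; k_{12}=\tfrac{9n^4\varsigma_1\omega\iota^2\mathcal L^4}{\underline{\boldsymbol\pi}\,\underline C^2},$$ $$k_{13}=3\overline{\boldsymbol\pi}n^2\varsigma_2\overline C^2\iota^2\mathcal L^2S,\; k_{14}=3\overline{\boldsymbol\pi}n^2\varsigma_2\overline C^2,\; k_{15}=\tfrac{3n^4\varsigma_2\overline C^2\iota^2\mathcal L^2}{\underline C^2},\; k_{16}=\tfrac{1-\bar\sigma_2^2}2,$$ $$\gamma^*_{1,c}=\frac{k_1k_7k_{10}}{2k_2k_5k_{11}+2k_2k_7k_{10}+2k_1k_4k_{11}+k_1k_6k_{10}},$$ $$\gamma^*_{2,c}=\sqrt{\frac{k_1k_{10}k_{11}}{2k_5k_8k_{11}+2k_7k_8k_{10}+2k_1k_9k_{11}+k_1k_{10}k_{12}}},\quad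 \gamma^*_{3,c}=\sqrt{\frac{k_1k_{10}k_{16}}{2k_5k_{11}k_{13}+2k_7k_{10}k_{13}+2k_1k_{11}k_{14}+k_1k_{10}k_{15}}}.$$ **Claim.** An admissible pair of norms exists, and the game has a unique NE $\mathbf x^*$. For every admissible pair of norms and all such constants $\underline C,\overline C$, if $0<\gamma<\min\{1/k_1,\gamma^*_{1,c},\gamma^*_{2,c},\gamma^*_{3,c}\}$, then there is $\rho\in(0,1)$, independent of the initial conditions, such that for every run of the algorithm each of $$\sup_{\ell\ge t}\|\mathbf x_\ell-\mathbf x^*\|_{\boldsymbol\pi}^2,\qquad \sup_{\ell\ge t}\sum_{i=1}^N\sum_{k=1}^{n_i}\|\mathbf g^i_{k,\ell}-A^i_\infty\mathbf g^i_{k,\ell}\|_{\boldsymbol\pi^i}^2,\qquad \sup_{\ell\ge t}\sum_{q\in\bar{\mathcal V}}\|\mathbf 1_n\mathsf y_{q,\ell}-\mathbf y_{q,\ell}\|_e^2$$ is finite and at most $c\,\rho^t$ for all $t\ge0$, with a constant $c$ that does not depend on $t$; here $\mathbf g^i_{k,\ell}=(g^i_{jk,\ell})_{j}$ and $\mathbf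 y_{q,\ell}=(y^p_{q,\ell})_{p}$. That is, the three quantities converge to zero linearly. -/

import Mathlib

open Filter Topology
open scoped Matrix

noncomputable section

namespace ClusterGame

/-! ### Weighted norms and matrices -/

/-- Euclidean norm of a real vector. -/
def norm2 {ι : Type*} [Fintype ι] (v : ι → ℝ) : ℝ := √(∑ j, v j ^ 2)

/-- Weighted Euclidean norm `‖u‖_w = ‖diag(√w)⁻¹ u‖₂`. -/
def wnorm {ι : Type*} [Fintype ι] (w u : ι → ℝ) : ℝ := norm2 (fun j => (√(w j))⁻¹ * u j)

/-- Weighted matrix norm `‖A‖_w = ‖diag(√w)⁻¹ A diag(√w)‖₂`, with the spectral norm. -/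
def wmatNorm {ι : Type*} [Fintype ι] [DecidableEq ι] (w : ι → ℝ) (A : Matrix ι ι ℝ) : ℝ :=
  ‖Matrix.toEuclideanCLM (n := ι) (𝕜 := ℝ)
    (Matrix.diagonal (fun j => (√(w j))⁻¹) * A * Matrix.diagonal (fun j => √(w j)))‖

/-- The infinite power `A_∞ = lim_k A ^ k`. -/
def infPow {ι : Type*} [Fintype ι] [DecidableEq ι] (A : Matrix ι ι ℝ) : Matrix ι ι ℝ :=
  limUnder atTop (fun k : ℕ => A ^ k)

/-- The right eigenvector of `A` for the eigenvalue `1` whose entries sum to `1`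
(it exists and is unique for the column-stochastic matrices considered below). -/
def perronVec {ι : Type*} [Fintype ι] (A : Matrix ι ι ℝ) : ι → ℝ :=
  Classical.epsilon (fun v : ι → ℝ => A *ᵥ v = v ∧ ∑ j, v j = 1)

/-- `A` is an adjacency matrix (nonnegative weights, `A j k > 0` iff there is an edge from `k`
to `j`) of a strongly connected digraph with all self-loops. -/
structure IsStronglyConnectedAdj {ι : Type*} (A : Matrix ι ι ℝ) : Prop where
  nonneg : ∀ j k, 0 ≤ A j k
  self_loop : ∀ k, 0 < A k k
  connected : ∀ j k, Relation.ReflTransGen (fun u v => 0 < A v u) j k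

/-- A vector norm `‖·‖_e` and a (submultiplicative) matrix norm `‖·‖_E` compatible with it. -/
structure NormPair (ι : Type*) [Fintype ι] where
  /-- the vector norm -/
  vec : Seminorm ℝ (ι → ℝ)
  /-- the matrix norm -/
  mat : Seminorm ℝ (Matrix ι ι ℝ)
  vec_definite : ∀ v, vec v = 0 → v = 0
  mat_definite : ∀ B, mat B = 0 → B = 0
  mat_mul_le : ∀ B D, mat (B * D) ≤ mat B * mat D
  compatible : ∀ B v, vec (B *ᵥ v) ≤ mat B * vec v

/-! ### The game -/

variable {N : ℕ} {n : Fin N → ℕ}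

/-- All agents; the pair `⟨i, j⟩` is agent `j` of cluster `i`. -/
abbrev Agent (n : Fin N → ℕ) : Type := (i : Fin N) × Fin (n i)

/-- Decision profiles: `x i j` is the decision of agent `j` in cluster `i`, and `x i` is the block
of decisions of cluster `i`. -/
abbrev Profile (n : Fin N → ℕ) : Type := (i : Fin N) → Fin (n i) → ℝ

/-- A profile as a vector indexed by all agents. -/
def flat (x : Profile n) : Agent n → ℝ := fun a => x a.1 a.2

/-- Local cost functions `J i j`. -/
abbrev LocalCosts (n : Fin N → ℕ) : Type := (i : Fin N) → Fin (n i) → Profile n → ℝ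

/-- Cluster-level cost, the average of the local costs in the cluster. -/
def clusterCost (J : LocalCosts n) (i : Fin N) (x : Profile n) : ℝ :=
  (1 / (n i : ℝ)) * ∑ j, J i j x

/-- `x` is a Nash equilibrium: no cluster can decrease its cost by changing its own block. -/
def IsNash (J : LocalCosts n) (x : Profile n) : Prop :=
  ∀ (i : Fin N) (z : Fin (n i) → ℝ),
    clusterCost J i x ≤ clusterCost J i (Function.update x i z)

/-- Partial derivative of `f` at `x` with respect to the decision of agent `k` in cluster `i`. -/
def pderiv (f : Profile n → ℝ) (i : Fin N) (k : Fin (n i)) (x : Profile n) : ℝ :=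
  deriv (fun s : ℝ => f (Function.update x i (Function.update (x i) k s))) (x i k)

/-- The game mapping `F(x) = (∇_{x^i} J^i(x))_i`. -/
def gameMap (J : LocalCosts n) (x : Profile n) : Profile n :=
  fun i k => pderiv (clusterCost J i) i k x

/-- Each local cost is convex and continuously differentiable in the decisions of its own cluster,
jointly continuous, and has `L`-Lipschitz partial gradients. -/
structure CostAssumption (J : LocalCosts n) (L : ℝ) : Prop where
  convex : ∀ i j (x : Profile n),
    ConvexOn ℝ Set.univ (fun z : Fin (n i) → ℝ => J i j (Function.update x i z))
  contDiff : ∀ i j (x : Profile n),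
    ContDiff ℝ 1 (fun z : Fin (n i) → ℝ => J i j (Function.update x i z))
  continuous : ∀ i j, Continuous (J i j)
  lipschitz : ∀ i j k (x x' : Profile n),
    |pderiv (J i j) i k x - pderiv (J i j) i k x'| ≤ L * norm2 (flat x - flat x')

/-- The game mapping is strongly monotone with constant `χ`. -/
def StronglyMonotone (J : LocalCosts n) (χ : ℝ) : Prop :=
  ∀ x x' : Profile n,
    χ * norm2 (flat x - flat x') ^ 2 ≤
      ∑ i, ∑ k, (gameMap J x i k - gameMap J x' i k) * (x i k - x' i k)

/-! ### The algorithm -/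

/-- The sequences `x` (decisions), `y` (`y t p` is the estimate of the whole profile held by agent
`p` at time `t`) and `g` (`g t i j k` is the tracker `g^i_{jk}` at time `t`) are generated by the
algorithm with step-sizes `γ`, from arbitrary `x 0` and `y 0`. -/
structure IsTrajectory (J : LocalCosts n) (A : (i : Fin N) → Matrix (Fin (n i)) (Fin (n i)) ℝ)
    (Abar : Matrix (Agent n) (Agent n) ℝ) (δ γ : Agent n → ℝ)
    (x : ℕ → Profile n) (y : ℕ → Agent n → Profile n)
    (g : ℕ → (i : Fin N) → Fin (n i) → Fin (n i) → ℝ) : Prop where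
  init : ∀ i j k, g 0 i j k = pderiv (J i j) i k (y 0 ⟨i, j⟩)
  estimate : ∀ t p q, flat (y (t + 1) p) q =
    ∑ l, Abar p l * flat (y t l) q + δ p * Abar p q * (flat (x t) q - flat (y t p) q)
  action : ∀ t i j, x (t + 1) i j = x t i j - γ ⟨i, j⟩ * g t i j j
  tracker : ∀ t i j k, g (t + 1) i j k =
    ∑ l, A i j l * g t i l k
      + pderiv (J i j) i k (y (t + 1) ⟨i, j⟩) - pderiv (J i j) i k (y t ⟨i, j⟩)

/-- The matrix `Ã_q`: the off-diagonal entries of `Ā`, and `|ā_pp - δ_p ā_pq|` on the diagonal. -/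
def Atilde (Abar : Matrix (Agent n) (Agent n) ℝ) (δ : Agent n → ℝ) (q : Agent n) :
    Matrix (Agent n) (Agent n) ℝ :=
  Matrix.of fun p m => if p = m then |Abar p p - δ p * Abar p q| else Abar p m

/-- The scaled eigenvector `n_i π^i`. -/
def bpi (A : (i : Fin N) → Matrix (Fin (n i)) (Fin (n i)) ℝ) : Profile n :=
  fun i j => (n i : ℝ) * perronVec (A i) j

/-! ### Error terms -/

/-- Squared weighted distance to `xs`. -/
def neGap (A : (i : Fin N) → Matrix (Fin (n i)) (Fin (n i)) ℝ) (xs x : Profile n) : ℝ :=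
  wnorm (flat (bpi A)) (flat x - flat xs) ^ 2

/-- Total gradient-tracking error. -/
def trackError (A : (i : Fin N) → Matrix (Fin (n i)) (Fin (n i)) ℝ)
    (g : (i : Fin N) → Fin (n i) → Fin (n i) → ℝ) : ℝ :=
  ∑ i, ∑ k, wnorm (bpi A i) ((fun j => g i j k) - infPow (A i) *ᵥ (fun j => g i j k)) ^ 2

/-- Total decision-estimation error, in the norm `‖·‖_e`. -/
def estError (P : NormPair (Agent n)) (x : Profile n) (y : Agent n → Profile n) : ℝ :=
  ∑ q, P.vec (fun p => flat x q - flat (y p) q) ^ 2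

/-- `sup_{ℓ ≥ t} u ℓ` is finite and converges to `0` (for `u ≥ 0`) linearly, with ratio `ρ`. -/
def TailSupLinear (u : ℕ → ℝ) (ρ : ℝ) : Prop :=
  BddAbove (Set.range u) ∧ ∃ C : ℝ, ∀ t : ℕ, (⨆ ℓ : Set.Ici t, u ℓ) ≤ C * ρ ^ t

/-! ### The constants -/

/-- The scalars from which the thresholds are computed. -/
structure Params where
  /-- number of agents -/
  n : ℝ
  /-- sum of the cubes of the cluster sizes -/
  cubes : ℝ
  /-- smallest entry of the vector of all `n_i π^i` -/
  piMin : ℝ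
  /-- largest entry of the vector of all `n_i π^i` -/
  piMax : ℝ
  /-- largest Euclidean norm of the `π^i` -/
  iota : ℝ
  /-- Lipschitz constant -/
  L : ℝ
  /-- strong monotonicity constant -/
  chi : ℝ
  /-- largest `σ_{A^i}` -/
  sigma1 : ℝ
  /-- largest `(1 + σ²) / (1 - σ²)` over the `σ_{A^i}` -/
  vs1 : ℝ
  /-- largest `σ_{Ã_q}` -/
  sigma2 : ℝ
  /-- largest `(1 + σ²) / (1 - σ²)` over the `σ_{Ã_q}` -/
  vs2 : ℝ
  /-- lower norm-equivalence constant -/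
  Clo : ℝ
  /-- upper norm-equivalence constant -/
  Cup : ℝ

namespace Params

variable (p : Params)

def k1 : ℝ := p.piMin * p.chi
def k2 : ℝ := 3 * p.piMax * p.iota ^ 2 * p.L ^ 2 / p.piMin * p.cubes
def k4 : ℝ := 3 * p.piMax / p.piMin
def k5 : ℝ := 3 / (p.piMin * p.chi)
def k6 : ℝ := 3 * p.n ^ 2 * p.iota ^ 2 * p.L ^ 2 / (p.piMin * p.Clo ^ 2)
def k7 : ℝ := 3 * p.piMax * p.n * p.L ^ 2 / (p.piMin * p.Clo ^ 2 * p.chi)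
def k8 : ℝ := 9 * p.piMax * p.n ^ 2 * p.vs1 * (1 + p.n * p.vs2 * p.Cup ^ 2) * p.iota ^ 2 * p.L ^ 4
  / p.piMin * p.cubes
def k9 : ℝ := 9 * p.piMax * p.n ^ 2 * p.vs1 * (1 + p.n * p.vs2 * p.Cup ^ 2) * p.L ^ 2
  / p.piMin * p.cubes
def k10 : ℝ := (1 - p.sigma1 ^ 2) / 2
def k11 : ℝ := 3 * p.n * p.vs1 * (3 + p.sigma2 ^ 2) * p.L ^ 2 / (2 * p.piMin * p.Clo ^ 2)
def k12 : ℝ := 9 * p.n ^ 4 * p.vs1 * (1 + p.n * p.vs2 * p.Cup ^ 2) * p.iota ^ 2 * p.L ^ 4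
  / (p.piMin * p.Clo ^ 2)
def k13 : ℝ := 3 * p.piMax * p.n ^ 2 * p.vs2 * p.Cup ^ 2 * p.iota ^ 2 * p.L ^ 2 * p.cubes
def k14 : ℝ := 3 * p.piMax * p.n ^ 2 * p.vs2 * p.Cup ^ 2
def k15 : ℝ := 3 * p.n ^ 4 * p.vs2 * p.Cup ^ 2 * p.iota ^ 2 * p.L ^ 2 / p.Clo ^ 2
def k16 : ℝ := (1 - p.sigma2 ^ 2) / 2

/-- The threshold `γ*_{1,c}`. -/
def gamma1 : ℝ := p.k1 * p.k7 * p.k10 /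
  (2 * p.k2 * p.k5 * p.k11 + 2 * p.k2 * p.k7 * p.k10 + 2 * p.k1 * p.k4 * p.k11
    + p.k1 * p.k6 * p.k10)

/-- The threshold `γ*_{2,c}`. -/
def gamma2 : ℝ := √(p.k1 * p.k10 * p.k11 /
  (2 * p.k5 * p.k8 * p.k11 + 2 * p.k7 * p.k8 * p.k10 + 2 * p.k1 * p.k9 * p.k11
    + p.k1 * p.k10 * p.k12))

/-- The threshold `γ*_{3,c}`. -/
def gamma3 : ℝ := √(p.k1 * p.k10 * p.k16 /
  (2 * p.k5 * p.k11 * p.k13 + 2 * p.k7 * p.k10 * p.k13 + 2 * p.k1 * p.k11 * p.k14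
    + p.k1 * p.k10 * p.k15))

end Params

/-- `σ_{A^i} = ‖A^i - A^i_∞‖` in the weighted norm given by `n_i π^i`. -/
def sigmaA (A : (i : Fin N) → Matrix (Fin (n i)) (Fin (n i)) ℝ) (i : Fin N) : ℝ :=
  wmatNorm (bpi A i) (A i - infPow (A i))

/-- `σ_{Ã_q} = ‖Ã_q‖_E`. -/
def sigmaAtilde (Abar : Matrix (Agent n) (Agent n) ℝ) (δ : Agent n → ℝ) (P : NormPair (Agent n))
    (q : Agent n) : ℝ :=
  P.mat (Atilde Abar δ q)

/-- The scalars determined by the networks, the costs and the norms. -/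
def params (A : (i : Fin N) → Matrix (Fin (n i)) (Fin (n i)) ℝ)
    (Abar : Matrix (Agent n) (Agent n) ℝ) (δ : Agent n → ℝ) (L χ : ℝ)
    (P : NormPair (Agent n)) (Clo Cup : ℝ) : Params where
  n := ∑ i, (n i : ℝ)
  cubes := ∑ i, (n i : ℝ) ^ 3
  piMin := ⨅ a, flat (bpi A) a
  piMax := ⨆ a, flat (bpi A) a
  iota := ⨆ i, norm2 (perronVec (A i))
  L := L
  chi := χ
  sigma1 := ⨆ i, sigmaA A i
  vs1 := ⨆ i, (1 + sigmaA A i ^ 2) / (1 - sigmaA A i ^ 2)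
  sigma2 := ⨆ q, sigmaAtilde Abar δ P q
  vs2 := ⨆ q, (1 + sigmaAtilde Abar δ P q ^ 2) / (1 - sigmaAtilde Abar δ P q ^ 2)
  Clo := Clo
  Cup := Cup

end ClusterGame

end

/-!
The proof has four parts.

*Networks of the clusters.* A column-stochastic matrix `A` of a strongly connected digraph with
self-loops has a unique positive fixed vector `π` of sum one. In the Euclidean norm weighted by
`1 / π`, the matrix `π 1ᵀ` is the orthogonal projection onto the line of `π`, and Jensen's
inequality makes `A` a strict contraction on the complement, the zero-sum vectors
(`IsStronglyConnectedAdj.sum_mulVec_sq_div_lt`). Hence `‖A - π 1ᵀ‖ < 1` in the weighted matrix norm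
and `A ^ k → π 1ᵀ`.

*Norms for the estimation network.* In a product of the matrices `Ã_q`, the set of rows that still
sum to one shrinks with every factor, so every product of as many factors as there are agents
contracts the sup norm. A weighted maximum of the sup norms of `Ã_w v` over shorter words `w` is
then a norm contracted by every `Ã_q` (`exists_normPair_of_leaderFollowing`).

*Equilibrium.* By convexity the Nash equilibria are the zeros of the game mapping `F`, which is
Lipschitz and strongly monotone, so that `x ↦ x - s F(x)` is a contraction for small `s > 0`
(`exists_unique_nash`).

*Convergence.* The decision step of an agent is its weighted pseudo-gradient plus a tracking and an
estimation error. In the norm weighted by `1 / (n_i π^i)` the weights cancel against strong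
monotonicity, and Young's inequality gives one-step inequalities between the gap to the
equilibrium, the tracking error and the estimation error (`Params.Step`, `ClusterNetworks.step`).
Below the thresholds these contract a box in the three quantities
(`Params.Admissible.exists_contracting_box`), so all three decay at a common rate.

The estimation error does not enter through its own norm. It evolves with a matrix that may have
negative diagonal entries, while the given norms only contract its entrywise absolute value `Ã_q`.
The inequalities are therefore stated for a majorant of the absolute errors that evolves with `Ã_q`
(`errBound`); the error itself is recovered from it by the equivalence of norms, at the price of a
constant factor.
-/

namespace ClusterGame

/-! ### Weighted Euclidean norms -/

section WeightedNorm

variable {ι : Type*} [Fintype ι]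

lemma norm2_nonneg (v : ι → ℝ) : 0 ≤ norm2 v := Real.sqrt_nonneg _

lemma norm2_sq (v : ι → ℝ) : norm2 v ^ 2 = ∑ j, v j ^ 2 :=
  Real.sq_sqrt (Finset.sum_nonneg fun _ _ => sq_nonneg _)

lemma norm2_eq_norm (v : ι → ℝ) : norm2 v = ‖WithLp.toLp 2 v‖ := by
  simp [norm2, EuclideanSpace.norm_eq]

lemma wnorm_nonneg (w u : ι → ℝ) : 0 ≤ wnorm w u := norm2_nonneg _

lemma wnorm_sq {w : ι → ℝ} (hw : ∀ j, 0 < w j) (u : ι → ℝ) :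
    wnorm w u ^ 2 = ∑ j, u j ^ 2 / w j := by
  rw [wnorm, norm2_sq]
  refine Finset.sum_congr rfl fun j _ => ?_
  rw [mul_pow, inv_pow, Real.sq_sqrt (hw j).le, div_eq_inv_mul]

lemma wnorm_add_le (w u v : ι → ℝ) : wnorm w (u + v) ≤ wnorm w u + wnorm w v := by
  simp only [wnorm, norm2_eq_norm]
  refine le_trans (le_of_eq ?_) (norm_add_le _ _)
  congr 1
  ext j
  simp [mul_add]

lemma wmatNorm_nonneg [DecidableEq ι] (w : ι → ℝ) (B : Matrix ι ι ℝ) : 0 ≤ wmatNorm w B :=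
  norm_nonneg _

lemma wnorm_mulVec_le [DecidableEq ι] {w : ι → ℝ} (hw : ∀ j, 0 < w j) (B : Matrix ι ι ℝ)
    (u : ι → ℝ) : wnorm w (B *ᵥ u) ≤ wmatNorm w B * wnorm w u := by
  have h := (Matrix.toEuclideanCLM (n := ι) (𝕜 := ℝ)
    (Matrix.diagonal (fun j => (√(w j))⁻¹) * B * Matrix.diagonal (fun j => √(w j)))).le_opNorm
      (WithLp.toLp 2 (fun j => (√(w j))⁻¹ * u j))
  rw [Matrix.toEuclideanCLM_toLp, ← norm2_eq_norm, ← norm2_eq_norm] at h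
  refine le_trans (le_of_eq ?_) h
  have hu : Matrix.diagonal (fun j => √(w j)) *ᵥ (fun j => (√(w j))⁻¹ * u j) = u := by
    ext j
    have : √(w j) ≠ 0 := (Real.sqrt_pos.2 (hw j)).ne'
    rw [Matrix.mulVec_diagonal, mul_inv_cancel_left₀ this]
  rw [← Matrix.mulVec_mulVec, hu, ← Matrix.mulVec_mulVec, wnorm]
  congr 1
  ext j
  rw [Matrix.mulVec_diagonal]

/-- A linear map on a finite-dimensional space that strictly decreases the norm of every nonzero
vector has operator norm less than one, by compactness of the unit ball. -/
lemma opNorm_lt_one_of_forall_norm_lt {E : Type*} [NormedAddCommGroup E] [NormedSpace ℝ E]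
    [FiniteDimensional ℝ E] (T : E →L[ℝ] E) (hT : ∀ u, u ≠ 0 → ‖T u‖ < ‖u‖) : ‖T‖ < 1 := by
  have : ProperSpace E := FiniteDimensional.proper ℝ E
  obtain ⟨u, hu, hmax⟩ := (isCompact_closedBall (0 : E) 1).exists_isMaxOn ⟨0, by simp⟩
    (f := fun u => ‖T u‖) (by fun_prop)
  have hle : ‖T‖ ≤ ‖T u‖ :=
    T.opNorm_le_of_unit_norm (norm_nonneg _) fun x hx => hmax (by simp [hx])
  refine hle.trans_lt ?_
  by_cases h0 : u = 0
  · simp [h0]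
  · exact (hT u h0).trans_le (by simpa using hu)

lemma wmatNorm_lt_one [DecidableEq ι] {w : ι → ℝ} (hw : ∀ j, 0 < w j) (B : Matrix ι ι ℝ)
    (hB : ∀ u, u ≠ 0 → ∑ j, (B *ᵥ u) j ^ 2 / w j < ∑ j, u j ^ 2 / w j) : wmatNorm w B < 1 := by
  refine opNorm_lt_one_of_forall_norm_lt _ fun u hu => ?_
  refine lt_of_pow_lt_pow_left₀ 2 (norm_nonneg _) ?_
  have hs : ∀ j, √(w j) ≠ 0 := fun j => (Real.sqrt_pos.2 (hw j)).ne'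
  have := hB (fun j => √(w j) * u j) fun h => hu <| by
    ext j
    exact (mul_eq_zero.1 (congrFun h j)).resolve_left (hs j)
  simp only [EuclideanSpace.real_norm_sq_eq, Matrix.ofLp_toEuclideanCLM]
  have hv : Matrix.diagonal (fun j => √(w j)) *ᵥ u.ofLp = fun j => √(w j) * u.ofLp j := by
    ext j; rw [Matrix.mulVec_diagonal]
  refine (Finset.sum_congr rfl fun j _ => ?_).trans_lt
    (this.trans_eq (Finset.sum_congr rfl fun j _ => ?_))
  · rw [← Matrix.mulVec_mulVec, hv, ← Matrix.mulVec_mulVec, Matrix.mulVec_diagonal, mul_pow,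
      inv_pow, Real.sq_sqrt (hw j).le, div_eq_inv_mul]
  · rw [mul_pow, Real.sq_sqrt (hw j).le, mul_div_cancel_left₀ _ (hw j).ne']

end WeightedNorm

/-! ### Perron vectors of column-stochastic matrices -/

section Perron

variable {ι : Type*} [Fintype ι] {A : Matrix ι ι ℝ}

lemma sum_mulVec_of_col_sum (hcol : ∀ k, ∑ j, A j k = 1) (v : ι → ℝ) :
    ∑ j, (A *ᵥ v) j = ∑ k, v k := by
  simp only [Matrix.mulVec, dotProduct]
  rw [Finset.sum_comm]
  simp [← Finset.sum_mul, hcol]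

/-- A nonnegative fixed vector is zero or has only positive entries. -/
lemma IsStronglyConnectedAdj.pos_of_fixed (hA : IsStronglyConnectedAdj A) {v : ι → ℝ}
    (hv : A *ᵥ v = v) (h0 : ∀ j, 0 ≤ v j) {k : ι} (hk : 0 < v k) (j : ι) : 0 < v j := by
  induction hA.connected k j with
  | refl => exact hk
  | @tail b c _ hbc ih =>
    rw [← congrFun hv c]
    refine (mul_pos hbc ih).trans_le ?_
    exact Finset.single_le_sum (f := fun m => A c m * v m)
      (fun m _ => mul_nonneg (hA.nonneg c m) (h0 m)) (Finset.mem_univ b)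

/-- The entrywise absolute value of a fixed vector is fixed: `|v| ≤ A |v|` entrywise, and both
sides have the same sum. -/
lemma IsStronglyConnectedAdj.abs_fixed (hA : IsStronglyConnectedAdj A)
    (hcol : ∀ k, ∑ j, A j k = 1) {v : ι → ℝ} (hv : A *ᵥ v = v) :
    A *ᵥ (fun j => |v j|) = fun j => |v j| := by
  have hle : ∀ j ∈ Finset.univ, |v j| ≤ (A *ᵥ fun j => |v j|) j := fun j _ => by
    conv_lhs => rw [← congrFun hv j]
    refine (Finset.abs_sum_le_sum_abs _ _).trans (le_of_eq ?_)
    exact Finset.sum_congr rfl fun m _ => by rw [abs_mul, abs_of_nonneg (hA.nonneg j m)]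
  have := (Finset.sum_eq_sum_iff_of_le hle).1 (sum_mulVec_of_col_sum hcol _).symm
  ext j
  exact (this j (Finset.mem_univ j)).symm

/-- The only fixed vector with zero sum is zero: otherwise `|v| + v` is a nonnegative nonzero fixed
vector that vanishes where `v` is negative. -/
lemma IsStronglyConnectedAdj.eq_zero_of_fixed (hA : IsStronglyConnectedAdj A)
    (hcol : ∀ k, ∑ j, A j k = 1) {v : ι → ℝ} (hv : A *ᵥ v = v) (hs : ∑ j, v j = 0) : v = 0 := by
  by_contra hne
  obtain ⟨k, hk⟩ : ∃ k, 0 < v k := by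
    by_contra! h
    exact hne (funext fun j => (Finset.sum_eq_zero_iff_of_nonpos fun j _ => h j).1 hs j
      (Finset.mem_univ j))
  obtain ⟨m, hm⟩ : ∃ k, v k < 0 := by
    by_contra! h
    exact hne (funext fun j => (Finset.sum_eq_zero_iff_of_nonneg fun j _ => h j).1 hs j
      (Finset.mem_univ j))
  have hfix : A *ᵥ ((fun j => |v j|) + v) = (fun j => |v j|) + v := by
    rw [Matrix.mulVec_add, hA.abs_fixed hcol hv, hv]
  have := hA.pos_of_fixed hfix (fun j => by simpa [add_comm] using neg_le_iff_add_nonneg.1 (neg_abs_le (v j)))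
    (k := k) (by simp only [Pi.add_apply]; positivity) m
  simp [abs_of_neg hm] at this

lemma IsStronglyConnectedAdj.exists_perron [DecidableEq ι] [Nonempty ι]
    (hA : IsStronglyConnectedAdj A) (hcol : ∀ k, ∑ j, A j k = 1) :
    ∃ v : ι → ℝ, A *ᵥ v = v ∧ ∑ j, v j = 1 := by
  obtain ⟨v, hv0, hv⟩ : ∃ v ≠ 0, (A - 1) *ᵥ v = 0 := by
    rw [Matrix.exists_mulVec_eq_zero_iff, ← Matrix.exists_vecMul_eq_zero_iff]
    refine ⟨1, one_ne_zero, ?_⟩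
    ext k
    rw [Matrix.vecMul_sub, Matrix.vecMul_one]
    simp [Matrix.vecMul, dotProduct, hcol]
  have hv : A *ᵥ v = v := by
    rwa [Matrix.sub_mulVec, Matrix.one_mulVec, sub_eq_zero] at hv
  have hs : ∑ j, v j ≠ 0 := fun h => hv0 (hA.eq_zero_of_fixed hcol hv h)
  refine ⟨(∑ j, v j)⁻¹ • v, by rw [Matrix.mulVec_smul, hv], ?_⟩
  simp [← Finset.mul_sum, hs]

lemma IsStronglyConnectedAdj.perronVec_spec [DecidableEq ι] [Nonempty ι]
    (hA : IsStronglyConnectedAdj A) (hcol : ∀ k, ∑ j, A j k = 1) :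
    A *ᵥ perronVec A = perronVec A ∧ ∑ j, perronVec A j = 1 :=
  Classical.epsilon_spec (hA.exists_perron hcol)

lemma IsStronglyConnectedAdj.perronVec_pos [DecidableEq ι] [Nonempty ι]
    (hA : IsStronglyConnectedAdj A) (hcol : ∀ k, ∑ j, A j k = 1) (j : ι) :
    0 < perronVec A j := by
  obtain ⟨hv, hs⟩ := hA.perronVec_spec hcol
  -- `|π| - (∑ |π|) π` is a fixed vector with zero sum, hence zero, so `π` has a constant sign.
  have hfix := hA.abs_fixed hcol hv
  set v := perronVec A
  have hdiff : (fun j => |v j|) - (∑ j, |v j|) • v = 0 := by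
    refine hA.eq_zero_of_fixed hcol ?_ ?_
    · rw [Matrix.mulVec_sub, Matrix.mulVec_smul, hv, hfix]
    · simp [Finset.sum_sub_distrib, ← Finset.mul_sum, hs]
  obtain ⟨k, hk⟩ : ∃ k, v k ≠ 0 := by
    by_contra! h
    simp [h] at hs
  have hpos := hA.pos_of_fixed hfix (fun j => abs_nonneg _) (abs_pos.2 hk)
  have hj : |v j| = (∑ j, |v j|) * v j := by
    have := congrFun hdiff j
    simpa [sub_eq_zero] using this
  have hS : 0 < ∑ j, |v j| := Finset.sum_pos (fun j _ => hpos j) ⟨j, Finset.mem_univ j⟩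
  have := hpos j
  rw [hj] at this
  exact pos_of_mul_pos_right this hS.le

/-- A column-stochastic matrix strictly contracts zero-sum vectors in the Euclidean norm weighted
by its Perron vector. Writing `u = π r`, row `j` loses the variance
`∑ k, A j k * π k * (r k - m j) ^ 2` of `r` around its mean `m j`; if all of these vanish then `r`
is constant along edges, hence constant. -/
lemma IsStronglyConnectedAdj.sum_mulVec_sq_div_lt (hA : IsStronglyConnectedAdj A)
    (hcol : ∀ k, ∑ j, A j k = 1) {v : ι → ℝ} (hv : A *ᵥ v = v) (hpos : ∀ j, 0 < v j)
    {u : ι → ℝ} (hu : ∑ j, u j = 0) (hne : u ≠ 0) :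
    ∑ j, (A *ᵥ u) j ^ 2 / v j < ∑ j, u j ^ 2 / v j := by
  have key : ∑ j, ∑ k, A j k * v k * (u k / v k - (A *ᵥ u) j / v j) ^ 2
      = ∑ j, u j ^ 2 / v j - ∑ j, (A *ᵥ u) j ^ 2 / v j := by
    have h1 : ∑ j, u j ^ 2 / v j = ∑ j, (A *ᵥ fun k => u k ^ 2 / v k) j :=
      (sum_mulVec_of_col_sum hcol _).symm
    rw [h1, ← Finset.sum_sub_distrib]
    refine Finset.sum_congr rfl fun j _ => ?_
    set m := (A *ᵥ u) j / v j with hm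
    have h2 : (A *ᵥ u) j ^ 2 / v j = 2 * m * (A *ᵥ u) j - m ^ 2 * (A *ᵥ v) j := by
      rw [hv, hm]
      have := (hpos j).ne'
      field_simp
      ring
    rw [h2]
    simp only [Matrix.mulVec, dotProduct, Finset.mul_sum]
    rw [← Finset.sum_sub_distrib, ← Finset.sum_sub_distrib]
    refine Finset.sum_congr rfl fun k _ => ?_
    have := (hpos k).ne'
    field_simp
    ring
  have hnn : ∀ j k, 0 ≤ A j k * v k * (u k / v k - (A *ᵥ u) j / v j) ^ 2 := fun j k =>
    mul_nonneg (mul_nonneg (hA.nonneg j k) (hpos k).le) (sq_nonneg _)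
  have h0 : 0 ≤ ∑ j, ∑ k, A j k * v k * (u k / v k - (A *ᵥ u) j / v j) ^ 2 :=
    Finset.sum_nonneg fun j _ => Finset.sum_nonneg fun k _ => hnn j k
  refine lt_of_le_of_ne (sub_nonneg.1 (key ▸ h0)) fun heq => hne ?_
  have hz : ∀ j k, 0 < A j k → u k / v k = (A *ᵥ u) j / v j := by
    intro j k hjk
    have h1 := (Finset.sum_eq_zero_iff_of_nonneg fun j _ =>
      Finset.sum_nonneg fun k _ => hnn j k).1 (key.trans (sub_eq_zero.2 heq.symm)) j (Finset.mem_univ j)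
    have h2 := (Finset.sum_eq_zero_iff_of_nonneg fun k _ => hnn j k).1 h1 k (Finset.mem_univ k)
    have h3 := (mul_eq_zero.1 h2).resolve_left (mul_pos hjk (hpos k)).ne'
    exact sub_eq_zero.1 (pow_eq_zero_iff two_ne_zero |>.1 h3)
  have hedge : ∀ j k, 0 < A j k → u j / v j = u k / v k := fun j k hjk =>
    (hz j j (hA.self_loop j)).trans (hz j k hjk).symm
  have hconst : ∀ j k, u k / v k = u j / v j := by
    intro j k
    induction hA.connected j k with
    | refl => rfl
    | @tail b c _ hbc ih => rw [hedge c b hbc, ih]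
  ext j
  have hr : ∀ k, u k = u j / v j * v k := fun k => by
    rw [← hconst j k, div_mul_cancel₀ _ (hpos k).ne']
  have hs : u j / v j * ∑ k, v k = 0 := by
    rw [← hu, Finset.mul_sum]
    exact Finset.sum_congr rfl fun k _ => (hr k).symm
  have hS : 0 < ∑ j, v j := Finset.sum_pos (fun j _ => hpos j) ⟨j, Finset.mem_univ j⟩
  rw [hr j, (mul_eq_zero.1 hs).resolve_right hS.ne', zero_mul, Pi.zero_apply]

/-- The rank-one projection `π 1ᵀ` onto the Perron direction. -/
noncomputable def perronProj (A : Matrix ι ι ℝ) : Matrix ι ι ℝ := Matrix.of fun j _ => perronVec A j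

lemma perronProj_mulVec (A : Matrix ι ι ℝ) (u : ι → ℝ) :
    perronProj A *ᵥ u = fun j => perronVec A j * ∑ k, u k := by
  ext j
  simp [perronProj, Matrix.mulVec, dotProduct, Finset.mul_sum]

/-- `π 1ᵀ` is the orthogonal projection for the Euclidean norm weighted by `π`. -/
lemma sum_sub_perron_sq_div {v : ι → ℝ} (hs : ∑ j, v j = 1) (hpos : ∀ j, 0 < v j) (u : ι → ℝ) :
    ∑ j, (u j - v j * ∑ k, u k) ^ 2 / v j = ∑ j, u j ^ 2 / v j - (∑ k, u k) ^ 2 := by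
  set s := ∑ k, u k with hsdef
  have : ∀ j, (u j - v j * s) ^ 2 / v j = u j ^ 2 / v j - 2 * s * u j + s ^ 2 * v j := fun j => by
    have := (hpos j).ne'
    field_simp
    ring
  simp only [this, Finset.sum_add_distrib, Finset.sum_sub_distrib, ← Finset.mul_sum, hs, ← hsdef]
  ring

variable [DecidableEq ι] [Nonempty ι]

lemma IsStronglyConnectedAdj.wmatNorm_sub_perronProj_lt_one (hA : IsStronglyConnectedAdj A)
    (hcol : ∀ k, ∑ j, A j k = 1) {c : ℝ} (hc : 0 < c) :
    wmatNorm (fun j => c * perronVec A j) (A - perronProj A) < 1 := by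
  obtain ⟨hv, hs⟩ := hA.perronVec_spec hcol
  have hpos := hA.perronVec_pos hcol
  refine wmatNorm_lt_one (fun j => mul_pos hc (hpos j)) _ fun u hu => ?_
  simp only [div_mul_eq_div_div_swap, ← Finset.sum_div]
  refine div_lt_div_of_pos_right ?_ hc
  set d : ι → ℝ := u - perronProj A *ᵥ u with hd
  have hdj : ∀ j, d j = u j - perronVec A j * ∑ k, u k := fun j => by
    rw [hd, perronProj_mulVec]; rfl
  have hd0 : ∑ j, d j = 0 := by
    simp [hdj, Finset.sum_sub_distrib, ← Finset.sum_mul, hs]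
  have hmul : (A - perronProj A) *ᵥ u = A *ᵥ d := by
    have : A *ᵥ (perronProj A *ᵥ u) = perronProj A *ᵥ u := by
      have h1 : perronProj A *ᵥ u = (∑ k, u k) • perronVec A := by
        rw [perronProj_mulVec]; ext j; simp [mul_comm]
      rw [h1, Matrix.mulVec_smul, hv]
    rw [hd, Matrix.mulVec_sub, this, Matrix.sub_mulVec]
  have hle := sum_sub_perron_sq_div hs hpos u
  simp only [← hdj] at hle
  rw [hmul]
  by_cases h0 : d = 0
  · rw [h0]
    obtain ⟨k, hk⟩ := Function.ne_iff.1 hu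
    simp only [Matrix.mulVec_zero, Pi.zero_apply, ne_eq, OfNat.ofNat_ne_zero, not_false_eq_true,
      zero_pow, zero_div, Finset.sum_const_zero]
    exact Finset.sum_pos' (fun j _ => div_nonneg (sq_nonneg _) (hpos j).le)
      ⟨k, Finset.mem_univ k, div_pos (sq_pos_of_ne_zero hk) (hpos k)⟩
  · have := hA.sum_mulVec_sq_div_lt hcol hv hpos hd0 h0
    exact this.trans_le (hle.trans_le (sub_le_self _ (sq_nonneg _)))

lemma IsStronglyConnectedAdj.pow_sub_perronProj (hA : IsStronglyConnectedAdj A)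
    (hcol : ∀ k, ∑ j, A j k = 1) (m : ℕ) :
    A ^ (m + 1) - perronProj A = (A - perronProj A) ^ (m + 1) := by
  obtain ⟨hv, hs⟩ := hA.perronVec_spec hcol
  have h1 : A * perronProj A = perronProj A := by
    ext j k
    simpa [perronProj, Matrix.mul_apply, Matrix.mulVec, dotProduct] using congrFun hv j
  have h2 : perronProj A * A = perronProj A := by
    ext j k
    simp [perronProj, Matrix.mul_apply, ← Finset.mul_sum, hcol]
  have h3 : perronProj A * perronProj A = perronProj A := by
    ext j k
    simp [perronProj, Matrix.mul_apply, ← Finset.mul_sum, hs]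
  have h4 : ∀ m : ℕ, A ^ m * perronProj A = perronProj A := fun m => by
    induction m with
    | zero => simp
    | succ m ih => rw [pow_succ, mul_assoc, h1, ih]
  induction m with
  | zero => simp
  | succ m ih =>
    rw [pow_succ (A - perronProj A), ← ih, sub_mul, mul_sub, mul_sub, ← pow_succ, h4, h2, h3]
    abel

lemma IsStronglyConnectedAdj.infPow_eq (hA : IsStronglyConnectedAdj A)
    (hcol : ∀ k, ∑ j, A j k = 1) : infPow A = perronProj A := by
  have hpos := hA.perronVec_pos hcol
  have hlt := hA.wmatNorm_sub_perronProj_lt_one hcol one_pos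
  simp only [one_mul] at hlt
  set B := A - perronProj A
  set σ := wmatNorm (perronVec A) B
  have hpow : ∀ (m : ℕ) (u : ι → ℝ),
      wnorm (perronVec A) (B ^ m *ᵥ u) ≤ σ ^ m * wnorm (perronVec A) u := fun m u => by
    induction m with
    | zero => simp
    | succ m ih =>
      rw [pow_succ', pow_succ', ← Matrix.mulVec_mulVec, mul_assoc]
      exact (wnorm_mulVec_le hpos _ _).trans (mul_le_mul_of_nonneg_left ih (wmatNorm_nonneg _ _))
  have hB : Tendsto (fun m : ℕ => B ^ m) atTop (𝓝 0) := by
    refine tendsto_pi_nhds.2 fun j => tendsto_pi_nhds.2 fun k => ?_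
    set c := wnorm (perronVec A) (Pi.single k 1)
    have hb : ∀ m : ℕ, |(B ^ m) j k| ≤ √(perronVec A j) * c * σ ^ m := fun m => by
      have h1 := hpow m (Pi.single k 1)
      rw [Matrix.mulVec_single_one] at h1
      have h2 : |(B ^ m) j k| / √(perronVec A j) ≤ wnorm (perronVec A) ((B ^ m).col k) := by
        refine Real.le_sqrt_of_sq_le (le_trans (le_of_eq ?_) (Finset.single_le_sum
          (f := fun j => ((√(perronVec A j))⁻¹ * (B ^ m).col k j) ^ 2)
          (fun _ _ => sq_nonneg _) (Finset.mem_univ j)))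
        rw [div_pow, sq_abs, mul_pow, inv_pow, div_eq_inv_mul, Matrix.col_apply]
      have h3 := (div_le_iff₀ (Real.sqrt_pos.2 (hpos j))).1 (h2.trans h1)
      linarith [h3]
    refine squeeze_zero_norm hb ?_
    simpa using (tendsto_pow_atTop_nhds_zero_of_lt_one (wmatNorm_nonneg _ _) hlt).const_mul
      (√(perronVec A j) * c)
  refine Tendsto.limUnder_eq ((tendsto_add_atTop_iff_nat 1).1 ?_)
  have h := ((tendsto_add_atTop_iff_nat 1).2 hB).add_const (perronProj A)
  rw [zero_add] at h
  refine h.congr fun m => ?_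
  rw [← hA.pow_sub_perronProj hcol, sub_add_cancel]

end Perron

/-! ### Operator norms of definite seminorms -/

section OperatorNorm

/-- The operator norm induced by a definite seminorm on a finite-dimensional space. The space
carries no topology here, so that the result applies to `ι → ℝ` with a norm other than the
sup norm. -/
lemma exists_operatorSeminorm {E : Type*} [AddCommGroup E] [Module ℝ E] [FiniteDimensional ℝ E]
    (p : Seminorm ℝ E) (hp : ∀ v, p v = 0 → v = 0) :
    ∃ q : Seminorm ℝ (E →ₗ[ℝ] E), (∀ T, q T = 0 → T = 0) ∧
      (∀ S T, q (S ∘ₗ T) ≤ q S * q T) ∧ (∀ T v, p (T v) ≤ q T * p v) ∧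
      ∀ T c, 0 ≤ c → (∀ v, p (T v) ≤ c * p v) → q T ≤ c := by
  let _ : NormedAddCommGroup E := AddGroupNorm.toNormedAddCommGroup
    { p.toAddGroupSeminorm with eq_zero_of_map_eq_zero' := hp }
  let _ : NormedSpace ℝ E := ⟨fun a v => (map_smul_eq_mul p a v).le⟩
  let e : (E →ₗ[ℝ] E) ≃ₗ[ℝ] (E →L[ℝ] E) := LinearMap.toContinuousLinearMap
  refine ⟨(normSeminorm ℝ (E →L[ℝ] E)).comp e.toLinearMap, fun T hT => ?_, fun S T => ?_,
    fun T v => ?_, fun T c hc h => ?_⟩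
  · exact e.map_eq_zero_iff.1 (norm_eq_zero.1 hT)
  · exact (e S).opNorm_comp_le (e T)
  · exact (e T).le_opNorm v
  · exact (e T).opNorm_le_bound hc h

lemma exists_normPair {ι : Type*} [Fintype ι] [DecidableEq ι] (p : Seminorm ℝ (ι → ℝ))
    (hp : ∀ v, p v = 0 → v = 0) :
    ∃ P : NormPair ι, P.vec = p ∧
      ∀ B c, 0 ≤ c → (∀ v, p (B *ᵥ v) ≤ c * p v) → P.mat B ≤ c := by
  obtain ⟨q, hdef, hmul, hcompat, hle⟩ := exists_operatorSeminorm p hp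
  refine ⟨⟨p, q.comp (Matrix.toLin' (R := ℝ) (m := ι) (n := ι)).toLinearMap, hp,
    fun B hB => ?_, fun B D => ?_, fun B v => ?_⟩, rfl, fun B c hc h => ?_⟩
  · exact Matrix.toLin'.map_eq_zero_iff.1 (hdef _ hB)
  · simpa [Matrix.toLin'_mul] using hmul (Matrix.toLin' B) (Matrix.toLin' D)
  · simpa using hcompat (Matrix.toLin' B) v
  · simpa using hle (Matrix.toLin' B) c hc (by simpa using h)

end OperatorNorm

/-! ### A common contraction norm for a finite family of matrices -/

section JointContraction

variable {ι κ : Type*} [Fintype ι] [Fintype κ]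

/-- The largest sup norm of `M q₁ ⋯ M q_m v` over all words `q₁, …, q_m` of length `m`. -/
noncomputable def wordSup (M : κ → Matrix ι ι ℝ) : ℕ → Seminorm ℝ (ι → ℝ)
  | 0 => normSeminorm ℝ (ι → ℝ)
  | m + 1 => Finset.univ.sup fun q => (wordSup M m).comp (Matrix.mulVecLin (M q))

lemma wordSup_mulVec_le (M : κ → Matrix ι ι ℝ) (m : ℕ) (q : κ) (v : ι → ℝ) :
    wordSup M m (M q *ᵥ v) ≤ wordSup M (m + 1) v :=
  Seminorm.le_finset_sup_apply (p := fun q => (wordSup M m).comp (Matrix.mulVecLin (M q)))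
    (Finset.mem_univ q)

lemma wordSup_le [DecidableEq ι] (M : κ → Matrix ι ι ℝ) {m : ℕ} {v : ι → ℝ} {c : ℝ} (hc : 0 ≤ c)
    (h : ∀ l : List κ, l.length = m → ‖(l.map M).prod *ᵥ v‖ ≤ c) : wordSup M m v ≤ c := by
  induction m generalizing v with
  | zero => simpa [wordSup] using h [] rfl
  | succ m ih =>
    refine Seminorm.finset_sup_apply_le hc fun q _ => ?_
    refine ih fun l hl => ?_
    simpa using h (l ++ [q]) (by simp [hl])

/-- If all products of `m` matrices of the family contract the sup norm by a common factor, then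
`v ↦ max_{k < m} β⁻ᵏ max_w ‖M_w v‖`, over words `w` of length `k`, is a norm that every matrix of
the family contracts by the factor `β`. -/
lemma exists_normPair_of_wordSup_le [DecidableEq ι] (M : κ → Matrix ι ι ℝ) {m : ℕ} (hm : 0 < m)
    {θ : ℝ} (hθ : θ < 1) (h : ∀ v, wordSup M m v ≤ θ * ‖v‖) :
    ∃ P : NormPair ι, ∀ q, P.mat (M q) < 1 := by
  obtain ⟨β, hβ0, hβ1, hβθ⟩ : ∃ β : NNReal, 0 < β ∧ β < 1 ∧ θ ≤ (β : ℝ) ^ m := by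
    have hx0 : 0 < max θ 2⁻¹ := lt_max_of_lt_right (by norm_num)
    have hx1 : max θ 2⁻¹ < 1 := max_lt hθ (by norm_num)
    have hpow : 0 < max θ 2⁻¹ ^ ((m : ℝ)⁻¹) := Real.rpow_pos_of_pos hx0 _
    refine ⟨(max θ 2⁻¹ ^ ((m : ℝ)⁻¹)).toNNReal, Real.toNNReal_pos.2 hpow,
      Real.toNNReal_lt_one.2 (Real.rpow_lt_one hx0.le hx1 (by positivity)), ?_⟩
    rw [Real.coe_toNNReal _ hpow.le, Real.rpow_inv_natCast_pow hx0.le hm.ne']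
    exact le_max_left _ _
  let s : ℕ → Seminorm ℝ (ι → ℝ) := fun k => (β ^ k)⁻¹ • wordSup M k
  have hs : ∀ k v, s k v = ((β : ℝ) ^ k)⁻¹ * wordSup M k v := fun k v => by
    simp only [s, smul_apply, NNReal.smul_def, smul_eq_mul]
    push_cast
    rfl
  have hβ0' : (0 : ℝ) < β := hβ0
  let p : Seminorm ℝ (ι → ℝ) := (Finset.range m).sup s
  have hsp : ∀ k < m, ∀ v, s k v ≤ p v := fun k hk v =>
    Seminorm.le_finset_sup_apply (Finset.mem_range.2 hk)
  have hnorm : ∀ v, ‖v‖ ≤ p v := fun v => by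
    have := hsp 0 hm v
    rw [hs] at this
    simpa [wordSup] using this
  obtain ⟨P, -, hP⟩ := exists_normPair p fun v hv =>
    norm_le_zero_iff.1 ((hnorm v).trans hv.le)
  refine ⟨P, fun q => (hP (M q) β β.coe_nonneg fun v => ?_).trans_lt (by exact_mod_cast hβ1)⟩
  refine Seminorm.finset_sup_apply_le (by positivity) fun k hk => ?_
  have hstep : s k (M q *ᵥ v) ≤ β * s (k + 1) v := by
    rw [hs, hs]
    calc ((β : ℝ) ^ k)⁻¹ * wordSup M k (M q *ᵥ v)
        ≤ ((β : ℝ) ^ k)⁻¹ * wordSup M (k + 1) v :=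
          mul_le_mul_of_nonneg_left (wordSup_mulVec_le M k q v) (by positivity)
      _ = β * (((β : ℝ) ^ (k + 1))⁻¹ * wordSup M (k + 1) v) := by
          rw [pow_succ]
          field_simp
  refine hstep.trans (mul_le_mul_of_nonneg_left ?_ hβ0'.le)
  rcases (Nat.succ_le_of_lt (Finset.mem_range.1 hk)).lt_or_eq with hlt | heq
  · exact hsp _ hlt v
  · rw [Nat.succ_eq_add_one] at heq
    rw [heq, hs, inv_mul_le_iff₀ (by positivity)]
    exact (h v).trans (mul_le_mul hβθ (hnorm v) (norm_nonneg _) (by positivity))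

end JointContraction

/-! ### Leader-following consensus matrices -/

section Consensus

variable {ι : Type*} [Fintype ι] [DecidableEq ι] {B : Matrix ι ι ℝ} {M : ι → Matrix ι ι ℝ}

/-- Row sums of the product of the matrices of a word. -/
def wordRowSum (M : ι → Matrix ι ι ℝ) (l : List ι) : ι → ℝ := (l.map M).prod *ᵥ 1

lemma wordRowSum_cons (M : ι → Matrix ι ι ℝ) (q : ι) (l : List ι) (p : ι) :
    wordRowSum M (q :: l) p = ∑ m, M q p m * wordRowSum M l m := by
  rw [wordRowSum, List.map_cons, List.prod_cons, ← Matrix.mulVec_mulVec]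
  rfl

lemma wordRowSum_nonneg (hM : ∀ q p m, 0 ≤ M q p m) (l : List ι) (p : ι) :
    0 ≤ wordRowSum M l p := by
  induction l generalizing p with
  | nil => simp [wordRowSum]
  | cons q l ih =>
    rw [wordRowSum_cons]
    exact Finset.sum_nonneg fun m _ => mul_nonneg (hM q p m) (ih m)

lemma wordRowSum_le_one (hM : ∀ q p m, 0 ≤ M q p m) (hMB : ∀ q p m, M q p m ≤ B p m)
    (hrow : ∀ p, ∑ m, B p m = 1) (l : List ι) (p : ι) : wordRowSum M l p ≤ 1 := by
  induction l generalizing p with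
  | nil => simp [wordRowSum]
  | cons q l ih =>
    rw [wordRowSum_cons, ← hrow p]
    exact Finset.sum_le_sum fun m _ =>
      (mul_le_of_le_one_right (hM q p m) (ih m)).trans (hMB q p m)

lemma abs_prod_mulVec_le (hM : ∀ q p m, 0 ≤ M q p m) (l : List ι) (v : ι → ℝ) (p : ι) :
    |((l.map M).prod *ᵥ v) p| ≤ wordRowSum M l p * ‖v‖ := by
  induction l generalizing p with
  | nil => simpa [wordRowSum] using norm_le_pi_norm v p
  | cons q l ih =>
    rw [wordRowSum_cons, List.map_cons, List.prod_cons, ← Matrix.mulVec_mulVec, Finset.sum_mul]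
    refine (Finset.abs_sum_le_sum_abs _ _).trans (Finset.sum_le_sum fun m _ => ?_)
    rw [abs_mul, abs_of_nonneg (hM q p m), mul_assoc]
    exact mul_le_mul_of_nonneg_left (ih m) (hM q p m)

/-- If row `p` of a word still has sum one after a letter `q` is put in front, then `p` does not
listen to the leader `q`, and all rows that `p` listens to had sum one before. -/
lemma of_wordRowSum_cons_eq_one (hB : IsStronglyConnectedAdj B) (hM : ∀ q p m, 0 ≤ M q p m)
    (hMB : ∀ q p m, M q p m ≤ B p m) (hrow : ∀ p, ∑ m, B p m = 1)
    (hlt : ∀ q p, 0 < B p q → M q p p < B p p) {q : ι} {l : List ι} {p : ι}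
    (h : wordRowSum M (q :: l) p = 1) :
    B p q = 0 ∧ ∀ m, 0 < B p m → wordRowSum M l m = 1 := by
  have hu := wordRowSum_le_one hM hMB hrow l
  have h0 := wordRowSum_nonneg hM l
  have hle : ∀ m ∈ Finset.univ, M q p m * wordRowSum M l m ≤ B p m := fun m _ =>
    (mul_le_of_le_one_right (hM q p m) (hu m)).trans (hMB q p m)
  rw [wordRowSum_cons, ← hrow p] at h
  have heq : ∀ m, M q p m * wordRowSum M l m = B p m := fun m =>
    (Finset.sum_eq_sum_iff_of_le hle).1 h m (Finset.mem_univ m)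
  constructor
  · by_contra hne
    have h1 := hlt q p (lt_of_le_of_ne (hB.nonneg p q) (Ne.symm hne))
    have h2 := mul_le_of_le_one_right (hM q p p) (hu p)
    rw [heq p] at h2
    exact absurd h2 h1.not_ge
  · intro m hm
    refine le_antisymm (hu m) ?_
    by_contra! hlt'
    have h1 : M q p m * wordRowSum M l m ≤ B p m * wordRowSum M l m :=
      mul_le_mul_of_nonneg_right (hMB q p m) (h0 m)
    have h2 : B p m * wordRowSum M l m < B p m := mul_lt_of_lt_one_right hm hlt'
    rw [heq m] at h1
    exact absurd h2 h1.not_gt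

/-- The set of rows with sum one strictly shrinks with every letter until it is empty: a nonempty
set that does not shrink is closed under listening, so by connectivity it contains the leader,
whose own row loses mass. -/
lemma card_wordRowSum_eq_one_add_length_le (hB : IsStronglyConnectedAdj B)
    (hM : ∀ q p m, 0 ≤ M q p m) (hMB : ∀ q p m, M q p m ≤ B p m) (hrow : ∀ p, ∑ m, B p m = 1)
    (hlt : ∀ q p, 0 < B p q → M q p p < B p p) (l : List ι) :
    Finset.univ.filter (fun p => wordRowSum M l p = 1) = ∅ ∨
      (Finset.univ.filter fun p => wordRowSum M l p = 1).card + l.length ≤ Fintype.card ι := by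
  induction l with
  | nil => right; simpa using Finset.card_le_univ _
  | cons q l ih =>
    set Z := Finset.univ.filter fun p => wordRowSum M l p = 1 with hZ
    set Z' := Finset.univ.filter fun p => wordRowSum M (q :: l) p = 1 with hZ'
    have hone : ∀ p ∈ Z', B p q = 0 ∧ ∀ m, 0 < B p m → m ∈ Z := fun p hp => by
      have := of_wordRowSum_cons_eq_one hB hM hMB hrow hlt (Finset.mem_filter.1 hp).2
      exact ⟨this.1, fun m hm => by simpa [hZ] using this.2 m hm⟩
    have hsub : Z' ⊆ Z := fun p hp => (hone p hp).2 p (hB.self_loop p)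
    by_cases hemp : Z' = ∅
    · exact Or.inl hemp
    right
    have hne : Z' ≠ Z := fun heq => by
      obtain ⟨p, hp⟩ := Finset.nonempty_iff_ne_empty.2 hemp
      have hq : q ∈ Z' := by
        refine Relation.ReflTransGen.head_induction_on (motive := fun a _ => a ∈ Z')
          (hB.connected q p) hp fun {a c} hac _ hc => ?_
        rw [heq]
        exact (hone c hc).2 a hac
      exact (hB.self_loop q).ne' (hone q hq).1
    have hcard : Z'.card < Z.card := Finset.card_lt_card (lt_of_le_of_ne hsub hne)
    rcases ih with h | h
    · rw [h] at hcard; simp at hcard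
    · rw [List.length_cons]; omega

/-- A family of substochastic matrices obtained from one row-stochastic matrix of a strongly
connected digraph, where in the matrix of leader `q` the agents listening to `q` lose mass, is
contracted by a common norm. -/
lemma exists_normPair_of_leaderFollowing [Nonempty ι] (hB : IsStronglyConnectedAdj B)
    (hM : ∀ q p m, 0 ≤ M q p m) (hMB : ∀ q p m, M q p m ≤ B p m) (hrow : ∀ p, ∑ m, B p m = 1)
    (hlt : ∀ q p, 0 < B p q → M q p p < B p p) :
    ∃ P : NormPair ι, ∀ q, P.mat (M q) < 1 := by
  have hword : ∀ l : List ι, l.length = Fintype.card ι → ∀ p, wordRowSum M l p < 1 := by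
    intro l hl p
    refine lt_of_le_of_ne (wordRowSum_le_one hM hMB hrow l p) fun h => ?_
    have hp : p ∈ Finset.univ.filter fun p => wordRowSum M l p = 1 := by simp [h]
    rcases card_wordRowSum_eq_one_add_length_le hB hM hMB hrow hlt l with h | h
    · rw [h] at hp; simp at hp
    · have := Finset.card_pos.2 ⟨p, hp⟩; omega
  obtain ⟨l₀, hl₀, hmax⟩ := Set.exists_max_image {l : List ι | l.length = Fintype.card ι}
    (fun l => ‖wordRowSum M l‖) (List.finite_length_eq ι _)
    ⟨List.replicate (Fintype.card ι) (Classical.arbitrary ι), List.length_replicate⟩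
  refine exists_normPair_of_wordSup_le M (Fintype.card_pos (α := ι)) (θ := ‖wordRowSum M l₀‖) ?_ fun v => ?_
  · refine (pi_norm_lt_iff one_pos).2 fun p => ?_
    rw [Real.norm_of_nonneg (wordRowSum_nonneg hM _ p)]
    exact hword l₀ hl₀ p
  · refine wordSup_le M (by positivity) fun l hl => ?_
    refine (pi_norm_le_iff_of_nonneg (by positivity)).2 fun p => ?_
    refine (abs_prod_mulVec_le hM l v p).trans (mul_le_mul_of_nonneg_right ?_ (norm_nonneg _))
    exact ((le_abs_self _).trans (norm_le_pi_norm (wordRowSum M l) p)).trans (hmax l hl)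

end Consensus

section Atilde

variable {N : ℕ} {n : Fin N → ℕ} {Abar : Matrix (Agent n) (Agent n) ℝ} {δ : Agent n → ℝ}

lemma Atilde_self (q p : Agent n) : Atilde Abar δ q p p = |Abar p p - δ p * Abar p q| := by
  simp [Atilde]

lemma Atilde_of_ne {q p m : Agent n} (h : p ≠ m) : Atilde Abar δ q p m = Abar p m := by
  simp [Atilde, h]

lemma Atilde_nonneg (hA : IsStronglyConnectedAdj Abar) (q p m : Agent n) :
    0 ≤ Atilde Abar δ q p m := by
  by_cases h : p = m
  · subst h; rw [Atilde_self]; exact abs_nonneg _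
  · rw [Atilde_of_ne h]; exact hA.nonneg p m

lemma exists_normPair_Atilde [Nonempty (Agent n)] (hAbar : IsStronglyConnectedAdj Abar)
    (hrow : ∀ p, ∑ q, Abar p q = 1) (hδpos : ∀ p, 0 < δ p)
    (hδ : ∀ p q, δ p * Abar p q < 2 * Abar p p) :
    ∃ P : NormPair (Agent n), ∀ q, P.mat (Atilde Abar δ q) < 1 := by
  refine exists_normPair_of_leaderFollowing hAbar (Atilde_nonneg hAbar) (fun q p m => ?_) hrow
    fun q p hpq => ?_
  · by_cases h : p = m
    · subst h
      rw [Atilde_self, abs_le]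
      have := mul_nonneg (hδpos p).le (hAbar.nonneg p q)
      constructor <;> linarith [hδ p q]
    · rw [Atilde_of_ne h]
  · rw [Atilde_self, abs_lt]
    have := mul_pos (hδpos p) hpq
    constructor <;> linarith [hδ p q]

end Atilde

/-! ### Zeros of strongly monotone Lipschitz maps -/

/-- A Lipschitz, strongly monotone map `F` on a Euclidean space has a zero: for a suitable step
`s > 0` the map `x ↦ x - s F(x)` is a contraction. -/
lemma exists_zero_of_stronglyMonotone {ι : Type*} [Fintype ι] {F : (ι → ℝ) → ι → ℝ} {L χ : ℝ}
    (hχ : 0 < χ) (hlip : ∀ a x x', |F x a - F x' a| ≤ L * norm2 (x - x'))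
    (hmono : ∀ x x', χ * norm2 (x - x') ^ 2 ≤ ∑ a, (F x a - F x' a) * (x a - x' a)) :
    ∃ x, F x = 0 := by
  -- The step `χ / M` gives the contraction factor `√(1 - χ² / M)`; the summand `χ²` in `M` makes
  -- the radicand nonnegative without comparing `χ` with `L`.
  set M := Fintype.card ι * L ^ 2 + χ ^ 2 with hM
  have hMpos : 0 < M := by positivity
  set s := χ / M with hs
  have hrad : 0 ≤ 1 - χ ^ 2 / M := by
    rw [sub_nonneg, div_le_one hMpos, hM]
    exact le_add_of_nonneg_left (by positivity)
  let T : EuclideanSpace ℝ ι → EuclideanSpace ℝ ι := fun u =>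
    WithLp.toLp 2 (fun a => u a - s * F u.ofLp a)
  have hT : ContractingWith (√(1 - χ ^ 2 / M)).toNNReal T := by
    refine ⟨Real.toNNReal_lt_one.2 ?_, LipschitzWith.of_dist_le_mul fun u v => ?_⟩
    · rw [Real.sqrt_lt' one_pos, one_pow]
      exact sub_lt_self _ (by positivity)
    · rw [Real.coe_toNNReal _ (Real.sqrt_nonneg _), EuclideanSpace.dist_eq, EuclideanSpace.dist_eq,
        ← Real.sqrt_mul hrad]
      refine Real.sqrt_le_sqrt ?_
      simp only [Real.dist_eq, sq_abs]
      have hd : norm2 (u.ofLp - v.ofLp) ^ 2 = ∑ a, (u a - v a) ^ 2 := norm2_sq _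
      have h1 := hmono u.ofLp v.ofLp
      have h2 : ∑ a, (F u.ofLp a - F v.ofLp a) ^ 2
          ≤ Fintype.card ι * L ^ 2 * ∑ a, (u a - v a) ^ 2 := by
        rw [mul_assoc, ← nsmul_eq_mul, ← hd, ← mul_pow]
        refine Finset.sum_le_card_nsmul _ _ _ fun a _ => ?_
        rw [← sq_abs]
        exact pow_le_pow_left₀ (abs_nonneg _) (hlip a _ _) 2
      rw [hd] at h1
      have h3 : ∑ a, (T u a - T v a) ^ 2 = ∑ a, (u a - v a) ^ 2
          - 2 * s * ∑ a, (F u.ofLp a - F v.ofLp a) * (u a - v a)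
          + s ^ 2 * ∑ a, (F u.ofLp a - F v.ofLp a) ^ 2 := by
        rw [Finset.mul_sum, Finset.mul_sum, ← Finset.sum_sub_distrib, ← Finset.sum_add_distrib]
        refine Finset.sum_congr rfl fun a _ => ?_
        simp only [T]
        ring
      have hs0 : 0 < s := by positivity
      have hD : 0 ≤ ∑ a, (u a - v a) ^ 2 := Finset.sum_nonneg fun _ _ => sq_nonneg _
      rw [h3]
      set D := ∑ a, (u a - v a) ^ 2
      calc _ ≤ D - 2 * s * (χ * D) + s ^ 2 * (Fintype.card ι * L ^ 2 * D) := by gcongr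
        _ ≤ D - 2 * s * (χ * D) + s ^ 2 * (M * D) := by
            gcongr
            exact le_add_of_nonneg_right (by positivity)
        _ = (1 - χ ^ 2 / M) * D := by
            rw [hs]
            field_simp
            ring
  refine ⟨(ContractingWith.fixedPoint T hT).ofLp, ?_⟩
  have hfix : T (ContractingWith.fixedPoint T hT) = ContractingWith.fixedPoint T hT :=
    hT.fixedPoint_isFixedPt
  ext a
  have ha := congrArg (fun u : EuclideanSpace ℝ ι => u.ofLp a) hfix
  have hs0 : s ≠ 0 := (div_pos hχ hMpos).ne'
  simpa [T, hs0] using ha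

/-! ### Nash equilibria of convex cluster games -/

/-- A critical point of a convex function is a global minimizer. -/
lemma _root_.ConvexOn.le_of_hasFDerivAt_zero {E : Type*} [NormedAddCommGroup E] [NormedSpace ℝ E]
    {f : E → ℝ} (hf : ConvexOn ℝ Set.univ f) {x : E} (hx : HasFDerivAt f (0 : E →L[ℝ] ℝ) x)
    (z : E) : f x ≤ f z := by
  let ℓ : ℝ →ᵃ[ℝ] E := AffineMap.lineMap x z
  have hconv : ConvexOn ℝ Set.univ (f ∘ ℓ) := by simpa using hf.comp_affineMap ℓ
  have hderiv : HasDerivAt (f ∘ ℓ) 0 0 := by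
    have h1 : HasDerivAt ℓ (z - x) 0 := AffineMap.hasDerivAt_lineMap
    have hx' : HasFDerivAt f (0 : E →L[ℝ] ℝ) (ℓ 0) := by simpa [ℓ] using hx
    simpa using hx'.comp_hasDerivAt (0 : ℝ) h1
  have := hconv.le_slope_of_hasDerivAt (Set.mem_univ 0) (Set.mem_univ 1) one_pos hderiv
  simpa [slope, ℓ] using this

section Game

variable {N : ℕ} {n : Fin N → ℕ} {J : LocalCosts n} {L : ℝ}

lemma hasDerivAt_update_of_hasFDerivAt {i : Fin N} {f : Profile n → ℝ} {x : Profile n}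
    {f' : (Fin (n i) → ℝ) →L[ℝ] ℝ}
    (hf : HasFDerivAt (fun z : Fin (n i) → ℝ => f (Function.update x i z)) f' (x i))
    (k : Fin (n i)) :
    HasDerivAt (fun s : ℝ => f (Function.update x i (Function.update (x i) k s)))
      (f' (Pi.single k 1)) (x i k) := by
  have hf' : HasFDerivAt (fun z : Fin (n i) → ℝ => f (Function.update x i z)) f'
      (Function.update (x i) k (x i k)) := by rwa [Function.update_eq_self]
  exact hf'.comp_hasDerivAt (x i k) (hasDerivAt_update (x i) k (x i k))

lemma CostAssumption.differentiableAt (hJ : CostAssumption J L) (i : Fin N) (j : Fin (n i))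
    (x : Profile n) (z : Fin (n i) → ℝ) :
    DifferentiableAt ℝ (fun z : Fin (n i) → ℝ => J i j (Function.update x i z)) z :=
  (hJ.contDiff i j x).differentiable one_ne_zero z

lemma CostAssumption.differentiableAt_clusterCost (hJ : CostAssumption J L) (i : Fin N)
    (x : Profile n) (z : Fin (n i) → ℝ) :
    DifferentiableAt ℝ (fun z : Fin (n i) → ℝ => clusterCost J i (Function.update x i z)) z :=
  (DifferentiableAt.fun_sum fun j _ => hJ.differentiableAt i j x z).const_mul _

lemma CostAssumption.convexOn_clusterCost (hJ : CostAssumption J L) (i : Fin N)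
    (x : Profile n) :
    ConvexOn ℝ Set.univ
      (fun z : Fin (n i) → ℝ => clusterCost J i (Function.update x i z)) := by
  have hsum : ∀ s : Finset (Fin (n i)), ConvexOn ℝ Set.univ
      (fun z : Fin (n i) → ℝ => ∑ j ∈ s, J i j (Function.update x i z)) := fun s => by
    classical
    induction s using Finset.induction_on with
    | empty => simpa using convexOn_const (0 : ℝ) convex_univ
    | insert a s ha ih =>
      simp only [Finset.sum_insert ha]
      exact (hJ.convex i a x).add ih
  exact (hsum Finset.univ).smul (by positivity : (0 : ℝ) ≤ 1 / (n i : ℝ))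

lemma CostAssumption.gameMap_apply (hJ : CostAssumption J L) (x : Profile n) (i : Fin N)
    (k : Fin (n i)) : gameMap J x i k = (1 / (n i : ℝ)) * ∑ j, pderiv (J i j) i k x := by
  have h : ∀ j, HasDerivAt
      (fun s : ℝ => J i j (Function.update x i (Function.update (x i) k s)))
      (pderiv (J i j) i k x) (x i k) := fun j =>
    (hasDerivAt_update_of_hasFDerivAt
      (hJ.differentiableAt i j x (x i)).hasFDerivAt k).differentiableAt.hasDerivAt
  exact ((HasDerivAt.fun_sum fun j _ => h j).const_mul (1 / (n i : ℝ))).deriv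

lemma CostAssumption.abs_gameMap_sub_le (hJ : CostAssumption J L) (hn : ∀ i, 0 < n i)
    (i : Fin N) (k : Fin (n i)) (x x' : Profile n) :
    |gameMap J x i k - gameMap J x' i k| ≤ L * norm2 (flat x - flat x') := by
  have hpos : (0 : ℝ) < n i := by exact_mod_cast hn i
  rw [hJ.gameMap_apply, hJ.gameMap_apply, ← mul_sub, ← Finset.sum_sub_distrib, abs_mul,
    abs_of_pos (by positivity), one_div, inv_mul_le_iff₀ hpos]
  refine (Finset.abs_sum_le_sum_abs _ _).trans ?_
  refine (Finset.sum_le_card_nsmul _ _ _ fun j _ => hJ.lipschitz i j k x x').trans (le_of_eq ?_)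
  simp

/-- By convexity, the Nash equilibria are the zeros of the game mapping. -/
lemma CostAssumption.isNash_iff (hJ : CostAssumption J L) (x : Profile n) :
    IsNash J x ↔ ∀ i k, gameMap J x i k = 0 := by
  have hd := fun i => (hJ.differentiableAt_clusterCost i x (x i)).hasFDerivAt
  have hpart : ∀ i k, gameMap J x i k = fderiv ℝ
      (fun z : Fin (n i) → ℝ => clusterCost J i (Function.update x i z)) (x i) (Pi.single k 1) :=
    fun i k => (hasDerivAt_update_of_hasFDerivAt (hd i) k).deriv
  constructor
  · intro h i k
    have hmin : IsLocalMin
        (fun z : Fin (n i) → ℝ => clusterCost J i (Function.update x i z)) (x i) :=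
      Filter.Eventually.of_forall fun z => by simpa using h i z
    rw [hpart, hmin.fderiv_eq_zero, zero_apply]
  · intro h i z
    have h0 : fderiv ℝ (fun z : Fin (n i) → ℝ => clusterCost J i (Function.update x i z)) (x i)
        = 0 := by
      refine ContinuousLinearMap.coe_injective (LinearMap.pi_ext' fun k => ?_)
      ext
      simpa [h i k] using (hpart i k).symm
    have := (hJ.convexOn_clusterCost i x).le_of_hasFDerivAt_zero (h0 ▸ hd i) z
    simpa using this

lemma exists_unique_nash (hn : ∀ i, 0 < n i) (hJ : CostAssumption J L) {χ : ℝ} (hχ : 0 < χ)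
    (hF : StronglyMonotone J χ) :
    ∃ xs : Profile n, (∀ i k, gameMap J xs i k = 0) ∧ ∀ z, IsNash J z ↔ z = xs := by
  let e : (Agent n → ℝ) → Profile n := fun u i k => u ⟨i, k⟩
  have he : ∀ u, flat (e u) = u := fun u => rfl
  obtain ⟨u, hu⟩ : ∃ u, (fun a : Agent n => gameMap J (e u) a.1 a.2) = 0 := by
    refine exists_zero_of_stronglyMonotone (L := L) hχ (fun a x x' => ?_) fun x x' => ?_
    · have h := hJ.abs_gameMap_sub_le hn a.1 a.2 (e x) (e x')
      rwa [he, he] at h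
    · have h := hF (e x) (e x')
      rw [he, he] at h
      rwa [Fintype.sum_sigma]
  set xs : Profile n := e u
  have hxs : ∀ i k, gameMap J xs i k = 0 := fun i k => congrFun hu ⟨i, k⟩
  refine ⟨xs, hxs, fun z => ⟨fun hz => ?_, fun hz => ?_⟩⟩
  · rw [hJ.isNash_iff] at hz
    have h := hF z xs
    simp only [hz, hxs, sub_self, zero_mul, Finset.sum_const_zero] at h
    have h0 : norm2 (flat z - flat xs) ^ 2 = 0 :=
      le_antisymm (nonpos_of_mul_nonpos_right h hχ) (sq_nonneg _)
    rw [norm2_sq, Finset.sum_eq_zero_iff_of_nonneg fun _ _ => sq_nonneg _] at h0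
    ext i k
    simpa [flat, sub_eq_zero] using h0 ⟨i, k⟩ (Finset.mem_univ _)
  · rw [hz, hJ.isNash_iff]
    exact hxs

end Game

/-! ### Linear decay from the small-gain inequalities -/

/-- Young's inequality in the form in which `ς = (1 + σ²) / (1 - σ²)` appears. -/
lemma sq_le_of_le_contraction_add {σ a b r : ℝ} (hσ1 : σ ^ 2 < 1) (hr : 0 ≤ r)
    (h : r ≤ σ * a + b) :
    r ^ 2 ≤ (1 + σ ^ 2) / 2 * a ^ 2 + (1 + σ ^ 2) / (1 - σ ^ 2) * b ^ 2 := by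
  have hc : 0 < 1 - σ ^ 2 := by linarith
  have h1 : r ^ 2 ≤ (σ * a + b) ^ 2 := pow_le_pow_left₀ hr h 2
  have h2 : (1 + σ ^ 2) / 2 * a ^ 2 + (1 + σ ^ 2) / (1 - σ ^ 2) * b ^ 2 - (σ * a + b) ^ 2
      = ((1 - σ ^ 2) * a - 2 * σ * b) ^ 2 / (2 * (1 - σ ^ 2)) := by
    field_simp
    ring
  have h3 : 0 ≤ ((1 - σ ^ 2) * a - 2 * σ * b) ^ 2 / (2 * (1 - σ ^ 2)) := by positivity
  linarith

lemma tailSupLinear_of_le {u : ℕ → ℝ} {C ρ : ℝ} (h0 : ∀ t, 0 ≤ u t) (hρ0 : 0 < ρ) (hρ1 : ρ < 1)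
    (h : ∀ t, u t ≤ C * ρ ^ t) : TailSupLinear u ρ := by
  have hC : 0 ≤ C := by simpa using (h0 0).trans (h 0)
  refine ⟨⟨C, ?_⟩, C, fun t => ciSup_le fun ℓ => (h ℓ).trans ?_⟩
  · rintro _ ⟨t, rfl⟩
    exact (h t).trans (mul_le_of_le_one_right hC (pow_le_one₀ hρ0.le hρ1.le))
  · exact mul_le_mul_of_nonneg_left (pow_le_pow_of_le_one hρ0.le hρ1.le ℓ.2) hC

namespace Params

/-- Coefficient of the squared distance to the equilibrium in the bound on the squared length
of a decision step (up to `3 γ ^ 2`). -/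
noncomputable def stepGap (p : Params) : ℝ := p.piMax * p.iota ^ 2 * p.L ^ 2 * p.cubes

/-- Coefficient of the estimation error in the bound on the squared length of a decision step
(up to `3 γ ^ 2`). -/
noncomputable def stepEst (p : Params) : ℝ := p.n ^ 2 * p.iota ^ 2 * p.L ^ 2 / p.Clo ^ 2

/-- The ranges of the scalars of a cluster game. -/
structure Admissible (p : Params) : Prop where
  n : 1 ≤ p.n
  cubes : 0 < p.cubes
  piMin : 0 < p.piMin
  piMax : 0 < p.piMax
  iota : 0 < p.iota
  chi : 0 < p.chi
  sigma1 : p.sigma1 ^ 2 < 1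
  sigma2 : p.sigma2 ^ 2 < 1
  vs1 : 1 ≤ p.vs1
  vs2 : 1 ≤ p.vs2
  Clo : 0 < p.Clo
  Clo_le_Cup : p.Clo ≤ p.Cup

/-- The inequalities that bound the gap `X'`, the tracking error `G'` and the estimation error `Y'`
after one iteration by their values `X`, `G`, `Y` before; `D` is the squared length of the decision
step. -/
structure Step (p : Params) (γ X G Y D X' G' Y' : ℝ) : Prop where
  step : D ≤ 3 * γ ^ 2 * (p.stepGap * X + p.piMax * G + p.stepEst * Y)
  gap : X' ≤ (1 - γ * p.k1 + γ ^ 2 * p.k2) * X + (γ * p.k5 + γ ^ 2 * p.k4) * G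
    + (γ * p.k7 + γ ^ 2 * p.k6) * Y
  track : G' ≤ (1 - p.k10) * G + 3 * p.n * p.vs1 * p.L ^ 2 / p.piMin *
    (Y' / p.Clo ^ 2 + Y / p.Clo ^ 2 + p.n * D)
  est : Y' ≤ (1 - p.k16) * Y + p.n * p.vs2 * p.Cup ^ 2 * D

/-- Signs of the coefficients that enter the one-step inequalities. -/
structure CoeffSigns (p : Params) : Prop where
  k1 : 0 < p.k1
  k2 : 0 < p.k2
  k4 : 0 < p.k4
  k5 : 0 < p.k5
  k6 : 0 < p.k6
  k7 : 0 < p.k7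
  k10 : 0 < p.k10
  k10_le : p.k10 ≤ 1 / 2
  k11 : 0 < p.k11
  k13 : 0 < p.k13
  k14 : 0 < p.k14
  k15 : 0 < p.k15
  k16 : 0 < p.k16
  k16_le : p.k16 ≤ 1 / 2
  stepGap : 0 < p.stepGap
  stepEst : 0 < p.stepEst

lemma Admissible.coeffSigns {p : Params} (hp : p.Admissible) (hL : p.L ≠ 0) : p.CoeffSigns := by
  obtain ⟨hn, hcubes, hm, hM, hι, hχ, hσ1, hσ2, hv1, hv2, hlo, hloup⟩ := hp
  have hup : 0 < p.Cup := hlo.trans_le hloup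
  have hn0 : 0 < p.n := one_pos.trans_le hn
  have hv10 : 0 < p.vs1 := one_pos.trans_le hv1
  have hv20 : 0 < p.vs2 := one_pos.trans_le hv2
  have hs1 := sq_nonneg p.sigma1
  have hs2 := sq_nonneg p.sigma2
  exact {
    k1 := mul_pos hm hχ
    k2 := by unfold k2; positivity
    k4 := by unfold k4; positivity
    k5 := by unfold k5; positivity
    k6 := by unfold k6; positivity
    k7 := by unfold k7; positivity
    k10 := by unfold k10; linarith only [hσ1]
    k10_le := by unfold k10; linarith only [hs1]
    k11 := by unfold k11; positivity
    k13 := by unfold k13; positivity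
    k14 := by unfold k14; positivity
    k15 := by unfold k15; positivity
    k16 := by unfold k16; linarith only [hσ2]
    k16_le := by unfold k16; linarith only [hs2]
    stepGap := by unfold stepGap; positivity
    stepEst := by unfold stepEst; positivity }

/-- Positive weights for which the right-hand sides of the one-step inequalities, evaluated at the
weights, are smaller than the weights. The estimation error drives the tracking error, and both
drive the gap; in this order the weights are chosen so large that the terms without the decision
step leave a margin, which the thresholds keep larger than the remaining terms. The decision step
enters the tracking error only through a term that `gamma3` already makes small against the
estimation error, since `Clo ≤ Cup`. -/
lemma Admissible.exists_weights {p : Params} (hp : p.Admissible) (hk : p.CoeffSigns) {γ : ℝ}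
    (hγ : 0 < γ) (hg1 : γ < p.gamma1) (hg3 : γ < p.gamma3) :
    ∃ Xh Gh Yh Dh r : ℝ, 0 < Xh ∧ 0 < Gh ∧ 0 < Yh ∧
      Dh = 3 * γ ^ 2 * (p.stepGap * Xh + p.piMax * Gh + p.stepEst * Yh) ∧
      (1 - γ * p.k1 + γ ^ 2 * p.k2) * Xh + (γ * p.k5 + γ ^ 2 * p.k4) * Gh
        + (γ * p.k7 + γ ^ 2 * p.k6) * Yh < Xh ∧
      r = (1 - p.k16) * Yh + p.n * p.vs2 * p.Cup ^ 2 * Dh ∧ r < Yh ∧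
      (1 - p.k10) * Gh + 3 * p.n * p.vs1 * p.L ^ 2 / p.piMin *
        (r / p.Clo ^ 2 + Yh / p.Clo ^ 2 + p.n * Dh) < Gh := by
  have k1p := hk.k1
  have k2p := hk.k2
  have k4p := hk.k4
  have k5p := hk.k5
  have k6p := hk.k6
  have k7p := hk.k7
  have k10p := hk.k10
  have k11p := hk.k11
  have k13p := hk.k13
  have k14p := hk.k14
  have k15p := hk.k15
  have hn0 : 0 < p.n := one_pos.trans_le hp.n
  obtain ⟨Xh, hXh⟩ : ∃ Xh, Xh = 2 * p.k5 * p.k11 + 2 * p.k7 * p.k10 := ⟨_, rfl⟩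
  obtain ⟨Gh, hGh⟩ : ∃ Gh, Gh = 2 * p.k1 * p.k11 := ⟨_, rfl⟩
  obtain ⟨Yh, hYh⟩ : ∃ Yh, Yh = p.k1 * p.k10 := ⟨_, rfl⟩
  obtain ⟨Dh, hDh⟩ : ∃ Dh, Dh = 3 * γ ^ 2 * (p.stepGap * Xh + p.piMax * Gh + p.stepEst * Yh) :=
    ⟨_, rfl⟩
  obtain ⟨r, hr⟩ : ∃ r, r = (1 - p.k16) * Yh + p.n * p.vs2 * p.Cup ^ 2 * Dh := ⟨_, rfl⟩
  obtain ⟨κ, hκ⟩ : ∃ κ, κ = 3 * p.n * p.vs1 * p.L ^ 2 / p.piMin := ⟨_, rfl⟩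
  have Xp : 0 < Xh := by rw [hXh]; positivity
  have Gp : 0 < Gh := by rw [hGh]; positivity
  have Yp : 0 < Yh := by rw [hYh]; positivity
  have Dp : 0 ≤ Dh := by
    have := hk.stepGap
    have := hk.stepEst
    have := hp.piMax
    rw [hDh]
    positivity
  have I1 : γ * (p.k2 * Xh + p.k4 * Gh + p.k6 * Yh) < p.k1 * p.k7 * p.k10 := by
    have h := (lt_div_iff₀ (by positivity)).1 hg1
    rw [hXh, hGh, hYh]
    linarith only [h]
  have I3 : p.n ^ 2 * p.vs2 * p.Cup ^ 2 * Dh < p.k16 * Yh := by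
    have h := (lt_div_iff₀ (by positivity)).1 ((Real.lt_sqrt hγ.le).1 hg3)
    have e : p.n ^ 2 * p.vs2 * p.Cup ^ 2 * Dh
        = γ ^ 2 * (p.k13 * Xh + p.k14 * Gh + p.k15 * Yh) := by
      rw [hDh]
      unfold stepGap stepEst k13 k14 k15
      ring
    rw [e, hXh, hGh, hYh]
    linarith only [h]
  have hv20 : 0 < p.vs2 := one_pos.trans_le hp.vs2
  have I3' : p.n * p.vs2 * p.Cup ^ 2 * Dh < p.k16 * Yh := by
    refine lt_of_le_of_lt ?_ I3
    have : p.n ≤ p.n ^ 2 := le_self_pow₀ hp.n two_ne_zero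
    gcongr
  have R3 : r < Yh := by rw [hr]; linarith only [I3']
  refine ⟨Xh, Gh, Yh, Dh, r, Xp, Gp, Yp, hDh, ?_, hr, R3, ?_⟩
  · rw [← sub_neg]
    refine lt_of_eq_of_lt ?_ (mul_neg_of_pos_of_neg hγ (sub_neg.2 I1))
    rw [hXh, hGh, hYh]
    ring
  · have hlo := hp.Clo
    have hD : p.n * Dh * p.Clo ^ 2 ≤ p.n * p.vs2 * p.Cup ^ 2 * Dh := by
      have h1 : 1 * p.Clo ^ 2 ≤ p.vs2 * p.Cup ^ 2 := by
        have := hp.vs2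
        have := hp.Clo_le_Cup
        gcongr
      have := mul_le_mul_of_nonneg_left h1 (mul_nonneg hn0.le Dp)
      linarith only [this]
    have hs : r + Yh + p.n * Dh * p.Clo ^ 2 < (3 + p.sigma2 ^ 2) * Yh := by
      have h1 : p.k16 * Yh ≤ 1 / 2 * Yh := mul_le_mul_of_nonneg_right hk.k16_le Yp.le
      have h2 := mul_nonneg (sq_nonneg p.sigma2) Yp.le
      linarith only [h1, h2, hD, I3', R3, Yp]
    have hm := hp.piMin
    have hL2 : 0 ≤ p.L ^ 2 := sq_nonneg _
    have e1 : r / p.Clo ^ 2 + Yh / p.Clo ^ 2 + p.n * Dh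
        = (r + Yh + p.n * Dh * p.Clo ^ 2) / p.Clo ^ 2 := by
      field_simp
    have e2 : p.k10 * Gh = κ * ((3 + p.sigma2 ^ 2) * Yh / p.Clo ^ 2) := by
      rw [hGh, hYh, hκ, k11]
      field_simp
    have κp : 0 < κ := by
      refine pos_of_mul_pos_left (e2 ▸ mul_pos k10p Gp) ?_
      positivity
    have := mul_lt_mul_of_pos_left (div_lt_div_of_pos_right hs (pow_pos hlo 2)) κp
    rw [← hκ, e1]
    linarith only [this, e2]

/-- Below the thresholds there is a box `[0, Xh] × [0, Gh] × [0, Yh]` all multiples of which are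
contracted by the iteration with a common factor. -/
lemma Admissible.exists_contracting_box {p : Params} (hp : p.Admissible) {γ : ℝ} (hγ : 0 < γ)
    (h1 : γ < 1 / p.k1) (hg1 : γ < p.gamma1) (hg3 : γ < p.gamma3) :
    ∃ ρ Xh Gh Yh : ℝ, 0 < ρ ∧ ρ < 1 ∧ 0 < Xh ∧ 0 < Gh ∧ 0 < Yh ∧
      ∀ c X G Y D X' G' Y', 0 ≤ c → p.Step γ X G Y D X' G' Y' →
        X ≤ c * Xh → G ≤ c * Gh → Y ≤ c * Yh →
        X' ≤ c * ρ * Xh ∧ G' ≤ c * ρ * Gh ∧ Y' ≤ c * ρ * Yh := by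
  -- A vanishing Lipschitz constant would make the threshold `gamma1` equal to zero.
  have hL : p.L ≠ 0 := fun h => by
    have : p.gamma1 = 0 := by simp [gamma1, k7, h]
    linarith
  have hk := hp.coeffSigns hL
  obtain ⟨Xh, Gh, Yh, Dh, r3, Xp, Gp, Yp, hDh, R1, hr3, R3, R2⟩ :=
    hp.exists_weights hk hγ hg1 hg3
  obtain ⟨r1, hr1⟩ : ∃ r, r = (1 - γ * p.k1 + γ ^ 2 * p.k2) * Xh
    + (γ * p.k5 + γ ^ 2 * p.k4) * Gh + (γ * p.k7 + γ ^ 2 * p.k6) * Yh := ⟨_, rfl⟩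
  obtain ⟨κ, hκ⟩ : ∃ κ, κ = 3 * p.n * p.vs1 * p.L ^ 2 / p.piMin := ⟨_, rfl⟩
  obtain ⟨r2, hr2⟩ : ∃ r, r = (1 - p.k10) * Gh
    + κ * (r3 / p.Clo ^ 2 + Yh / p.Clo ^ 2 + p.n * Dh) := ⟨_, rfl⟩
  rw [← hr1] at R1
  rw [← hκ, ← hr2] at R2
  have hn0 : 0 < p.n := one_pos.trans_le hp.n
  have κp : 0 ≤ κ := by
    have := hp.piMin
    have : 0 < p.vs1 := one_pos.trans_le hp.vs1
    rw [hκ]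
    positivity
  refine ⟨max (max (r1 / Xh) (r2 / Gh)) (max (r3 / Yh) (1 / 2)), Xh, Gh, Yh, ?_, ?_, Xp, Gp, Yp,
    ?_⟩
  · exact lt_max_of_lt_right (lt_max_of_lt_right (by norm_num))
  · exact max_lt (max_lt ((div_lt_one Xp).2 R1) ((div_lt_one Gp).2 R2))
      (max_lt ((div_lt_one Yp).2 R3) (by norm_num))
  intro c X G Y D X' G' Y' hc hs hX hG hY
  have hM := hp.piMax
  have k2p := hk.k2
  have k4p := hk.k4
  have k5p := hk.k5
  have k6p := hk.k6
  have k7p := hk.k7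
  have hap := hk.stepGap
  have hcp := hk.stepEst
  set ρ := max (max (r1 / Xh) (r2 / Gh)) (max (r3 / Yh) (1 / 2))
  have ρ1 : r1 ≤ ρ * Xh := (div_le_iff₀ Xp).1 (le_max_of_le_left (le_max_left _ _))
  have ρ2 : r2 ≤ ρ * Gh := (div_le_iff₀ Gp).1 (le_max_of_le_left (le_max_right _ _))
  have ρ3 : r3 ≤ ρ * Yh := (div_le_iff₀ Yp).1 (le_max_of_le_right (le_max_left _ _))
  have hc1 : 0 ≤ 1 - γ * p.k1 := by
    have := (lt_div_iff₀ hk.k1).1 h1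
    linarith only [this]
  have bD : D ≤ c * Dh := calc
    D ≤ 3 * γ ^ 2 * (p.stepGap * X + p.piMax * G + p.stepEst * Y) := hs.step
    _ ≤ 3 * γ ^ 2 * (p.stepGap * (c * Xh) + p.piMax * (c * Gh) + p.stepEst * (c * Yh)) := by
        gcongr
    _ = c * Dh := by rw [hDh]; ring
  have bX : X' ≤ c * r1 := calc
    X' ≤ _ := hs.gap
    _ ≤ (1 - γ * p.k1 + γ ^ 2 * p.k2) * (c * Xh) + (γ * p.k5 + γ ^ 2 * p.k4) * (c * Gh)
        + (γ * p.k7 + γ ^ 2 * p.k6) * (c * Yh) := by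
        have : 0 ≤ 1 - γ * p.k1 + γ ^ 2 * p.k2 := by positivity
        gcongr
    _ = c * r1 := by rw [hr1]; ring
  have bY : Y' ≤ c * r3 := calc
    Y' ≤ _ := hs.est
    _ ≤ (1 - p.k16) * (c * Yh) + p.n * p.vs2 * p.Cup ^ 2 * (c * Dh) := by
        have : 0 ≤ 1 - p.k16 := by linarith only [hk.k16_le]
        have := one_pos.trans_le hp.vs2
        gcongr
    _ = c * r3 := by rw [hr3]; ring
  have bG : G' ≤ c * r2 := calc
    G' ≤ (1 - p.k10) * G + κ * (Y' / p.Clo ^ 2 + Y / p.Clo ^ 2 + p.n * D) := hκ ▸ hs.track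
    _ ≤ (1 - p.k10) * (c * Gh)
        + κ * (c * r3 / p.Clo ^ 2 + c * Yh / p.Clo ^ 2 + p.n * (c * Dh)) := by
        have : 0 ≤ 1 - p.k10 := by linarith only [hk.k10_le]
        gcongr
    _ = c * r2 := by rw [hr2]; ring
  refine ⟨bX.trans ?_, bG.trans ?_, bY.trans ?_⟩ <;> rw [mul_assoc] <;> gcongr

/-- Below the thresholds, three nonnegative sequences linked by the one-step inequalities decay at
a common linear rate. -/
lemma Admissible.exists_rate {p : Params} (hp : p.Admissible) {γ : ℝ} (hγ : 0 < γ)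
    (h1 : γ < 1 / p.k1) (hg1 : γ < p.gamma1) (hg3 : γ < p.gamma3) :
    ∃ ρ : ℝ, 0 < ρ ∧ ρ < 1 ∧ ∀ X G Y D : ℕ → ℝ,
      (∀ t, 0 ≤ X t) → (∀ t, 0 ≤ G t) → (∀ t, 0 ≤ Y t) →
      (∀ t, p.Step γ (X t) (G t) (Y t) (D t) (X (t + 1)) (G (t + 1)) (Y (t + 1))) →
      ∃ C, ∀ t, X t ≤ C * ρ ^ t ∧ G t ≤ C * ρ ^ t ∧ Y t ≤ C * ρ ^ t := by
  obtain ⟨ρ, Xh, Gh, Yh, hρ0, hρ1, Xp, Gp, Yp, hstep⟩ :=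
    hp.exists_contracting_box hγ h1 hg1 hg3
  refine ⟨ρ, hρ0, hρ1, fun X G Y D hX hG hY hs => ?_⟩
  have x0 := div_nonneg (hX 0) Xp.le
  have g0 := div_nonneg (hG 0) Gp.le
  have y0 := div_nonneg (hY 0) Yp.le
  obtain ⟨c, hc⟩ : ∃ c, c = X 0 / Xh + G 0 / Gh + Y 0 / Yh := ⟨_, rfl⟩
  have hc0 : 0 ≤ c := by rw [hc]; positivity
  have key : ∀ t, X t ≤ c * ρ ^ t * Xh ∧ G t ≤ c * ρ ^ t * Gh ∧ Y t ≤ c * ρ ^ t * Yh := by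
    intro t
    induction t with
    | zero =>
      rw [pow_zero, mul_one, ← div_le_iff₀ Xp, ← div_le_iff₀ Gp, ← div_le_iff₀ Yp, hc]
      refine ⟨?_, ?_, ?_⟩ <;> linarith
    | succ t ih =>
      rw [pow_succ, ← mul_assoc]
      exact hstep _ _ _ _ _ _ _ _ (by positivity) (hs t) ih.1 ih.2.1 ih.2.2
  refine ⟨c * (Xh + Gh + Yh), fun t => ?_⟩
  have hle : ∀ u ≤ Xh + Gh + Yh, c * ρ ^ t * u ≤ c * (Xh + Gh + Yh) * ρ ^ t := fun u hu => by
    rw [mul_right_comm]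
    gcongr
  exact ⟨(key t).1.trans (hle _ (by linarith)), (key t).2.1.trans (hle _ (by linarith)),
    (key t).2.2.trans (hle _ (by linarith))⟩

end Params

/-! ### Weighted gradient steps -/

section GradientStep

variable {ι : Type*} [Fintype ι] {w d F h e : ι → ℝ} {lo up χ γ : ℝ}

/-- One step of a gradient method with weights `w` and perturbations `h`, `e`, in the norm that is
weighted by `1 / w`, so that the weights cancel in the product of `d` with the gradient `F`. -/
lemma sum_gradient_step_sq_div_le (hlo : 0 < lo) (hw : ∀ a, lo ≤ w a) (hup : ∀ a, w a ≤ up)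
    (hχ : 0 < χ) (hγ : 0 < γ) (hmono : χ * ∑ a, d a ^ 2 ≤ ∑ a, F a * d a) :
    ∑ a, (d a - γ * (w a * F a + w a * h a + e a)) ^ 2 / w a ≤
      (1 - γ * (lo * χ)) * ∑ a, d a ^ 2 / w a + γ * (3 / (lo * χ)) * ∑ a, e a ^ 2 / w a
        + γ * (3 * up / (lo * χ)) * ∑ a, h a ^ 2
        + γ ^ 2 / lo * ∑ a, (w a * F a + w a * h a + e a) ^ 2 := by
  obtain ⟨k, hk⟩ : ∃ k, k = lo * χ := ⟨_, rfl⟩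
  have hk0 : 0 < k := by rw [hk]; positivity
  have hterm : ∀ a, (d a - γ * (w a * F a + w a * h a + e a)) ^ 2 / w a ≤
      (1 + γ * (2 * k / 3)) * (d a ^ 2 / w a) - 2 * γ * (F a * d a)
        + γ * (3 / k) * (e a ^ 2 / w a) + γ * (3 * up / k) * h a ^ 2
        + γ ^ 2 / lo * (w a * F a + w a * h a + e a) ^ 2 := fun a => by
    have hwa : 0 < w a := hlo.trans_le (hw a)
    have e1 : (d a - γ * (w a * F a + w a * h a + e a)) ^ 2 / w a
        = d a ^ 2 / w a - 2 * γ * (F a * d a) + γ * (-2 * (d a * h a))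
          + γ * (-2 * (d a * e a / w a)) + γ ^ 2 * ((w a * F a + w a * h a + e a) ^ 2 / w a) := by
      field_simp
      ring
    have e2 : -2 * (d a * h a) ≤ k / 3 * (d a ^ 2 / w a) + 3 * up / k * h a ^ 2 := by
      have h1 : 3 * w a / k * h a ^ 2 ≤ 3 * up / k * h a ^ 2 := by
        gcongr
        exact hup a
      have h2 : k / 3 * (d a ^ 2 / w a) + 3 * w a / k * h a ^ 2 + 2 * (d a * h a)
          = (k * d a + 3 * w a * h a) ^ 2 / (3 * k * w a) := by
        field_simp
        ring
      have h3 : 0 ≤ (k * d a + 3 * w a * h a) ^ 2 / (3 * k * w a) := by positivity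
      linarith
    have e3 : -2 * (d a * e a / w a) ≤ k / 3 * (d a ^ 2 / w a) + 3 / k * (e a ^ 2 / w a) := by
      have h2 : k / 3 * (d a ^ 2 / w a) + 3 / k * (e a ^ 2 / w a) + 2 * (d a * e a / w a)
          = (k * d a + 3 * e a) ^ 2 / (3 * k * w a) := by
        field_simp
        ring
      have h3 : 0 ≤ (k * d a + 3 * e a) ^ 2 / (3 * k * w a) := by positivity
      linarith
    have e4 : (w a * F a + w a * h a + e a) ^ 2 / w a
        ≤ (w a * F a + w a * h a + e a) ^ 2 / lo :=
      div_le_div_of_nonneg_left (sq_nonneg _) hlo (hw a)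
    have e2' := mul_le_mul_of_nonneg_left e2 hγ.le
    have e3' := mul_le_mul_of_nonneg_left e3 hγ.le
    have e4' := mul_le_mul_of_nonneg_left e4 (sq_nonneg γ)
    rw [e1]
    calc _ ≤ d a ^ 2 / w a - 2 * γ * (F a * d a)
          + γ * (k / 3 * (d a ^ 2 / w a) + 3 * up / k * h a ^ 2)
          + γ * (k / 3 * (d a ^ 2 / w a) + 3 / k * (e a ^ 2 / w a))
          + γ ^ 2 * ((w a * F a + w a * h a + e a) ^ 2 / lo) := by gcongr
      _ = _ := by ring
  have hd : lo * ∑ a, d a ^ 2 / w a ≤ ∑ a, d a ^ 2 := by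
    rw [Finset.mul_sum]
    refine Finset.sum_le_sum fun a _ => ?_
    have hwa : 0 < w a := hlo.trans_le (hw a)
    rw [mul_div_assoc', div_le_iff₀ hwa, mul_comm]
    exact mul_le_mul_of_nonneg_left (hw a) (sq_nonneg _)
  have hX : 0 ≤ ∑ a, d a ^ 2 / w a :=
    Finset.sum_nonneg fun a _ => div_nonneg (sq_nonneg _) (hlo.le.trans (hw a))
  have hFd : k * ∑ a, d a ^ 2 / w a ≤ ∑ a, F a * d a := by
    refine le_trans ?_ hmono
    rw [hk, mul_comm lo, mul_assoc]
    exact mul_le_mul_of_nonneg_left hd hχ.le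
  refine (Finset.sum_le_sum fun a _ => hterm a).trans ?_
  simp only [Finset.sum_add_distrib, Finset.sum_sub_distrib, ← Finset.mul_sum, ← hk]
  have := mul_le_mul_of_nonneg_left hFd hγ.le
  have hγk := mul_nonneg (mul_nonneg hγ.le hk0.le) hX
  linarith

lemma sum_direction_sq_le {L Q B : ℝ} (hw : ∀ a, 0 < w a) (hup : ∀ a, w a ≤ up)
    (hF : ∀ a, F a ^ 2 ≤ L ^ 2 * ∑ b, d b ^ 2) (hQ : ∑ a, w a ^ 2 ≤ Q)
    (hB : ∀ a, w a ^ 2 ≤ B) :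
    ∑ a, (w a * F a + w a * h a + e a) ^ 2 ≤
      3 * (up * L ^ 2 * Q * ∑ a, d a ^ 2 / w a + up * ∑ a, e a ^ 2 / w a
        + B * ∑ a, h a ^ 2) := by
  have hsum : ∀ u : ι → ℝ, ∑ a, u a ^ 2 ≤ up * ∑ a, u a ^ 2 / w a := fun u => by
    rw [Finset.mul_sum]
    refine Finset.sum_le_sum fun a _ => ?_
    rw [mul_div_assoc', le_div_iff₀ (hw a), mul_comm]
    exact mul_le_mul_of_nonneg_right (hup a) (sq_nonneg _)
  have h1 : ∑ a, w a ^ 2 * F a ^ 2 ≤ up * L ^ 2 * Q * ∑ a, d a ^ 2 / w a := by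
    have hD : 0 ≤ ∑ b, d b ^ 2 := Finset.sum_nonneg fun _ _ => sq_nonneg _
    have hQ0 : 0 ≤ Q := (Finset.sum_nonneg fun _ _ => sq_nonneg _).trans hQ
    calc ∑ a, w a ^ 2 * F a ^ 2 ≤ ∑ a, w a ^ 2 * (L ^ 2 * ∑ b, d b ^ 2) := by
          gcongr with a
          exact hF a
      _ = (∑ a, w a ^ 2) * (L ^ 2 * ∑ b, d b ^ 2) := by rw [Finset.sum_mul]
      _ ≤ Q * (L ^ 2 * (up * ∑ a, d a ^ 2 / w a)) := by
          gcongr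
          exact hsum d
      _ = _ := by ring
  have h2 : ∑ a, w a ^ 2 * h a ^ 2 ≤ B * ∑ a, h a ^ 2 := by
    rw [Finset.mul_sum]
    gcongr with a
    exact hB a
  calc ∑ a, (w a * F a + w a * h a + e a) ^ 2
      ≤ ∑ a, 3 * (w a ^ 2 * F a ^ 2 + e a ^ 2 + w a ^ 2 * h a ^ 2) := by
        refine Finset.sum_le_sum fun a _ => ?_
        nlinarith [sq_nonneg (w a * F a - w a * h a), sq_nonneg (w a * F a - e a),
          sq_nonneg (w a * h a - e a)]
    _ = 3 * (∑ a, w a ^ 2 * F a ^ 2 + ∑ a, e a ^ 2 + ∑ a, w a ^ 2 * h a ^ 2) := by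
        rw [← Finset.mul_sum, Finset.sum_add_distrib, Finset.sum_add_distrib]
    _ ≤ _ := by
        have := hsum e
        gcongr

end GradientStep

variable {N : ℕ} {n : Fin N → ℕ} {J : LocalCosts n} {L χ γ : ℝ}
  {A : (i : Fin N) → Matrix (Fin (n i)) (Fin (n i)) ℝ} {Abar : Matrix (Agent n) (Agent n) ℝ}
  {δ : Agent n → ℝ} {x : ℕ → Profile n} {y : ℕ → Agent n → Profile n}
  {g : ℕ → (i : Fin N) → Fin (n i) → Fin (n i) → ℝ}

/-! ### Gradient tracking -/

/-- Tracking preserves the column sums of the trackers relative to the local gradients. -/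
lemma IsTrajectory.sum_tracker {γ : Agent n → ℝ} (h : IsTrajectory J A Abar δ γ x y g)
    (hcol : ∀ i k, ∑ j, A i j k = 1) (t : ℕ) (i : Fin N) (k : Fin (n i)) :
    ∑ j, g t i j k = ∑ j, pderiv (J i j) i k (y t ⟨i, j⟩) := by
  induction t with
  | zero => simp only [h.init]
  | succ t ih =>
    have h1 : ∑ j, ∑ l, A i j l * g t i l k = ∑ j, g t i j k :=
      sum_mulVec_of_col_sum (hcol i) (fun l => g t i l k)
    simp only [h.tracker, Finset.sum_sub_distrib, Finset.sum_add_distrib, h1, ih]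
    ring

/-- Deviation of the tracker `g^i_{kk}` used by agent `(i, k)` from its consensus value. -/
noncomputable def trackDev (A : (i : Fin N) → Matrix (Fin (n i)) (Fin (n i)) ℝ)
    (g : (i : Fin N) → Fin (n i) → Fin (n i) → ℝ) (a : Agent n) : ℝ :=
  g a.1 a.2 a.2 - (infPow (A a.1) *ᵥ fun j => g a.1 j a.2) a.2

/-- Error of the cluster gradient at agent `(i, k)` when each member of the cluster differentiates
its cost at its own estimate instead of the true profile. -/
noncomputable def gradErr (J : LocalCosts n) (x : Profile n) (y : Agent n → Profile n)
    (a : Agent n) : ℝ :=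
  (1 / (n a.1 : ℝ)) * ∑ l, (pderiv (J a.1 l) a.1 a.2 (y ⟨a.1, l⟩) - pderiv (J a.1 l) a.1 a.2 x)

/-- Squared Euclidean estimation error. -/
noncomputable def estGap (x : Profile n) (y : Agent n → Profile n) : ℝ :=
  ∑ p, norm2 (flat (y p) - flat x) ^ 2

lemma sum_trackDev_sq_div_le (hpos : ∀ i j, 0 < bpi A i j)
    (g : (i : Fin N) → Fin (n i) → Fin (n i) → ℝ) :
    ∑ a, trackDev A g a ^ 2 / flat (bpi A) a ≤ trackError A g := by
  rw [Fintype.sum_sigma, trackError]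
  refine Finset.sum_le_sum fun i _ => Finset.sum_le_sum fun k _ => ?_
  rw [wnorm_sq (hpos i)]
  exact Finset.single_le_sum
    (f := fun j => ((fun j => g i j k) - infPow (A i) *ᵥ fun j => g i j k) j ^ 2 / bpi A i j)
    (fun j _ => div_nonneg (sq_nonneg _) (hpos i j).le) (Finset.mem_univ k)

lemma CostAssumption.sq_pderiv_sub_le (hJ : CostAssumption J L) (i : Fin N) (j k : Fin (n i))
    (x x' : Profile n) :
    (pderiv (J i j) i k x - pderiv (J i j) i k x') ^ 2 ≤ L ^ 2 * norm2 (flat x - flat x') ^ 2 := by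
  rw [← sq_abs, ← mul_pow]
  exact pow_le_pow_left₀ (abs_nonneg _) (hJ.lipschitz i j k x x') 2

lemma CostAssumption.sum_gradErr_sq_le (hJ : CostAssumption J L) (hn : ∀ i, 0 < n i)
    (x : Profile n) (y : Agent n → Profile n) :
    ∑ a, gradErr J x y a ^ 2 ≤ L ^ 2 * estGap x y := by
  rw [Fintype.sum_sigma, estGap, Fintype.sum_sigma, Finset.mul_sum]
  refine Finset.sum_le_sum fun i _ => ?_
  have hpos : (0 : ℝ) < n i := by exact_mod_cast hn i
  have hk : ∀ k ∈ Finset.univ, gradErr J x y ⟨i, k⟩ ^ 2 ≤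
      (1 / (n i : ℝ)) * ∑ l, L ^ 2 * norm2 (flat (y ⟨i, l⟩) - flat x) ^ 2 := fun k _ => by
    have h1 : (∑ l, (pderiv (J i l) i k (y ⟨i, l⟩) - pderiv (J i l) i k x)) ^ 2 ≤
        n i * ∑ l, L ^ 2 * norm2 (flat (y ⟨i, l⟩) - flat x) ^ 2 := by
      refine sq_sum_le_card_mul_sum_sq.trans ?_
      rw [Finset.card_univ, Fintype.card_fin]
      gcongr with l
      exact hJ.sq_pderiv_sub_le i l k _ _
    calc gradErr J x y ⟨i, k⟩ ^ 2
        = (1 / (n i : ℝ)) ^ 2 *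
          (∑ l, (pderiv (J i l) i k (y ⟨i, l⟩) - pderiv (J i l) i k x)) ^ 2 := mul_pow _ _ _
      _ ≤ (1 / (n i : ℝ)) ^ 2 * (n i * ∑ l, L ^ 2 * norm2 (flat (y ⟨i, l⟩) - flat x) ^ 2) := by
          gcongr
      _ = _ := by field_simp
  refine (Finset.sum_le_card_nsmul _ _ _ hk).trans (le_of_eq ?_)
  rw [Finset.card_univ, Fintype.card_fin, nsmul_eq_mul, ← mul_assoc, mul_one_div_cancel hpos.ne',
    one_mul, Finset.mul_sum]

lemma sigmaA_nonneg (i : Fin N) : 0 ≤ sigmaA A i := wmatNorm_nonneg _ _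

/-- The standing assumptions on the networks of the clusters. -/
structure ClusterNetworks (A : (i : Fin N) → Matrix (Fin (n i)) (Fin (n i)) ℝ) : Prop where
  card_pos : ∀ i, 0 < n i
  connected : ∀ i, IsStronglyConnectedAdj (A i)
  col_sum : ∀ i k, ∑ j, A i j k = 1

namespace ClusterNetworks

lemma nonempty (hA : ClusterNetworks A) (i : Fin N) : Nonempty (Fin (n i)) :=
  Fin.pos_iff_nonempty.1 (hA.card_pos i)

lemma perronVec_pos (hA : ClusterNetworks A) (i : Fin N) (j : Fin (n i)) :
    0 < perronVec (A i) j :=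
  have := hA.nonempty i
  (hA.connected i).perronVec_pos (hA.col_sum i) j

lemma sum_perronVec (hA : ClusterNetworks A) (i : Fin N) : ∑ j, perronVec (A i) j = 1 :=
  have := hA.nonempty i
  ((hA.connected i).perronVec_spec (hA.col_sum i)).2

lemma bpi_pos (hA : ClusterNetworks A) (i : Fin N) (j : Fin (n i)) : 0 < bpi A i j :=
  mul_pos (by exact_mod_cast hA.card_pos i) (hA.perronVec_pos i j)

lemma infPow_eq (hA : ClusterNetworks A) (i : Fin N) : infPow (A i) = perronProj (A i) :=
  have := hA.nonempty i
  (hA.connected i).infPow_eq (hA.col_sum i)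

lemma infPow_mulVec (hA : ClusterNetworks A) (i : Fin N) (u : Fin (n i) → ℝ) :
    infPow (A i) *ᵥ u = fun j => perronVec (A i) j * ∑ k, u k := by
  rw [hA.infPow_eq, perronProj_mulVec]

lemma sigmaA_lt_one (hA : ClusterNetworks A) (i : Fin N) : sigmaA A i < 1 := by
  have := hA.nonempty i
  rw [sigmaA, hA.infPow_eq]
  exact (hA.connected i).wmatNorm_sub_perronProj_lt_one (hA.col_sum i)
    (by exact_mod_cast hA.card_pos i)

/-- Removing the consensus component does not increase the weighted norm. -/
lemma wnorm_sub_infPow_le (hA : ClusterNetworks A) (i : Fin N) (u : Fin (n i) → ℝ) :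
    wnorm (bpi A i) (u - infPow (A i) *ᵥ u) ≤ wnorm (bpi A i) u := by
  refine (pow_le_pow_iff_left₀ (wnorm_nonneg _ _) (wnorm_nonneg _ _) two_ne_zero).1 ?_
  rw [wnorm_sq (hA.bpi_pos i), wnorm_sq (hA.bpi_pos i), hA.infPow_mulVec]
  have h := sum_sub_perron_sq_div (hA.sum_perronVec i) (hA.perronVec_pos i) u
  simp only [bpi, div_mul_eq_div_div_swap, ← Finset.sum_div, Pi.sub_apply]
  rw [h]
  exact div_le_div_of_nonneg_right (sub_le_self _ (sq_nonneg _)) (Nat.cast_nonneg _)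

/-- One step of gradient tracking contracts the distance to consensus, up to the change of the
local gradients. -/
lemma wnorm_tracker_sq_le (hA : ClusterNetworks A) (i : Fin N) (u Δ : Fin (n i) → ℝ) :
    wnorm (bpi A i) ((A i *ᵥ u + Δ) - infPow (A i) *ᵥ (A i *ᵥ u + Δ)) ^ 2 ≤
      (1 + sigmaA A i ^ 2) / 2 * wnorm (bpi A i) (u - infPow (A i) *ᵥ u) ^ 2
        + (1 + sigmaA A i ^ 2) / (1 - sigmaA A i ^ 2) * wnorm (bpi A i) Δ ^ 2 := by
  have := hA.nonempty i
  refine sq_le_of_le_contraction_add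
    (pow_lt_one₀ (sigmaA_nonneg i) (hA.sigmaA_lt_one i) two_ne_zero) (wnorm_nonneg _ _) ?_
  have hfix := ((hA.connected i).perronVec_spec (hA.col_sum i)).1
  have hs := hA.sum_perronVec i
  have h1 : (A i *ᵥ u + Δ) - infPow (A i) *ᵥ (A i *ᵥ u + Δ)
      = (A i - infPow (A i)) *ᵥ (u - infPow (A i) *ᵥ u) + (Δ - infPow (A i) *ᵥ Δ) := by
    have e1 : infPow (A i) *ᵥ (A i *ᵥ u) = infPow (A i) *ᵥ u := by
      rw [hA.infPow_mulVec, hA.infPow_mulVec, sum_mulVec_of_col_sum (hA.col_sum i)]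
    have e2 : A i *ᵥ (infPow (A i) *ᵥ u) = infPow (A i) *ᵥ u := by
      have : infPow (A i) *ᵥ u = (∑ k, u k) • perronVec (A i) := by
        rw [hA.infPow_mulVec]; ext j; simp [mul_comm]
      rw [this, Matrix.mulVec_smul, hfix]
    have e3 : infPow (A i) *ᵥ (infPow (A i) *ᵥ u) = infPow (A i) *ᵥ u := by
      rw [hA.infPow_mulVec i u, hA.infPow_mulVec]
      simp [← Finset.sum_mul, hs]
    rw [Matrix.mulVec_add, Matrix.sub_mulVec, Matrix.mulVec_sub, Matrix.mulVec_sub, e1, e2, e3]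
    abel
  rw [h1]
  refine (wnorm_add_le _ _ _).trans (add_le_add ?_ (hA.wnorm_sub_infPow_le i Δ))
  exact wnorm_mulVec_le (hA.bpi_pos i) _ _

/-- The total tracking error contracts, up to the movement of the estimates. -/
lemma trackError_succ_le (hA : ClusterNetworks A) (hJ : CostAssumption J L) {γ : Agent n → ℝ}
    (h : IsTrajectory J A Abar δ γ x y g) {σ ς lo c : ℝ}
    (hσ : ∀ i, sigmaA A i ≤ σ) (hς0 : 0 ≤ ς)
    (hς : ∀ i, (1 + sigmaA A i ^ 2) / (1 - sigmaA A i ^ 2) ≤ ς)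
    (hlo : 0 < lo) (hw : ∀ i j, lo ≤ bpi A i j) (hc : ∀ i, (n i : ℝ) ≤ c) (t : ℕ) :
    trackError A (g (t + 1)) ≤ (1 + σ ^ 2) / 2 * trackError A (g t)
      + ς * (c * L ^ 2 / lo) * ∑ p, norm2 (flat (y (t + 1) p) - flat (y t p)) ^ 2 := by
  set M : Agent n → ℝ := fun p => norm2 (flat (y (t + 1) p) - flat (y t p)) ^ 2 with hM
  have hblock : ∀ i k, wnorm (bpi A i) ((fun j => g (t + 1) i j k)
        - infPow (A i) *ᵥ fun j => g (t + 1) i j k) ^ 2 ≤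
      (1 + σ ^ 2) / 2 * wnorm (bpi A i) ((fun j => g t i j k)
        - infPow (A i) *ᵥ fun j => g t i j k) ^ 2 + ς * (L ^ 2 / lo * ∑ j, M ⟨i, j⟩) := by
    intro i k
    have hg : (fun j => g (t + 1) i j k) = A i *ᵥ (fun j => g t i j k)
        + fun j => pderiv (J i j) i k (y (t + 1) ⟨i, j⟩) - pderiv (J i j) i k (y t ⟨i, j⟩) := by
      ext j
      rw [h.tracker, Pi.add_apply, add_sub_assoc]
      rfl
    rw [hg]
    refine (hA.wnorm_tracker_sq_le i _ _).trans ?_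
    have h1 : wnorm (bpi A i) (fun j => pderiv (J i j) i k (y (t + 1) ⟨i, j⟩)
        - pderiv (J i j) i k (y t ⟨i, j⟩)) ^ 2 ≤ L ^ 2 / lo * ∑ j, M ⟨i, j⟩ := by
      rw [wnorm_sq (hA.bpi_pos i), Finset.mul_sum]
      refine Finset.sum_le_sum fun j _ => ?_
      rw [div_mul_eq_mul_div]
      exact div_le_div₀ (mul_nonneg (sq_nonneg _) (sq_nonneg _)) (hJ.sq_pderiv_sub_le i j k _ _)
        hlo (hw i j)
    have h2 := hσ i
    have h3 := sigmaA_nonneg (A := A) i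
    have h4 := hς i
    gcongr
  calc trackError A (g (t + 1))
      ≤ ∑ i, ∑ k, ((1 + σ ^ 2) / 2 * wnorm (bpi A i) ((fun j => g t i j k)
        - infPow (A i) *ᵥ fun j => g t i j k) ^ 2 + ς * (L ^ 2 / lo * ∑ j, M ⟨i, j⟩)) :=
        Finset.sum_le_sum fun i _ => Finset.sum_le_sum fun k _ => hblock i k
    _ = (1 + σ ^ 2) / 2 * trackError A (g t)
        + ∑ i, (n i : ℝ) * (ς * (L ^ 2 / lo * ∑ j, M ⟨i, j⟩)) := by
        rw [trackError, Finset.mul_sum, ← Finset.sum_add_distrib]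
        refine Finset.sum_congr rfl fun i _ => ?_
        rw [Finset.sum_add_distrib, ← Finset.mul_sum Finset.univ (fun k => wnorm _ _ ^ 2),
          Finset.sum_const, Finset.card_univ, Fintype.card_fin, nsmul_eq_mul]
    _ ≤ (1 + σ ^ 2) / 2 * trackError A (g t)
        + ∑ i, c * (ς * (L ^ 2 / lo * ∑ j, M ⟨i, j⟩)) := by
        have hnn : ∀ i, 0 ≤ ∑ j, M ⟨i, j⟩ := fun i => Finset.sum_nonneg fun j _ => sq_nonneg _
        refine add_le_add le_rfl (Finset.sum_le_sum fun i _ => ?_)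
        have := hnn i
        exact mul_le_mul_of_nonneg_right (hc i) (by positivity)
    _ = _ := by
        rw [Fintype.sum_sigma, ← Finset.mul_sum, ← Finset.mul_sum, ← Finset.mul_sum]
        ring

/-- The decision step of an agent is the weighted pseudo-gradient, perturbed by the estimation and
the tracking error. -/
lemma tracker_diag (hA : ClusterNetworks A) (hJ : CostAssumption J L) {γ : Agent n → ℝ}
    (h : IsTrajectory J A Abar δ γ x y g) (t : ℕ) (a : Agent n) :
    g t a.1 a.2 a.2 = flat (bpi A) a * flat (gameMap J (x t)) a
      + flat (bpi A) a * gradErr J (x t) (y t) a + trackDev A (g t) a := by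
  have hpos : (n a.1 : ℝ) ≠ 0 := by exact_mod_cast (hA.card_pos a.1).ne'
  rw [trackDev, hA.infPow_mulVec, h.sum_tracker hA.col_sum, gradErr, flat, flat, bpi,
    hJ.gameMap_apply, Finset.sum_sub_distrib]
  field_simp
  ring

end ClusterNetworks

/-! ### Estimation of the decisions -/

/-- A nonnegative majorant of the estimation errors. The errors evolve with a matrix whose diagonal
may be negative and whose entrywise absolute value is `Ã_q`; a norm that contracts `Ã_q` need not
contract that matrix, so the recursion with `Ã_q` is run on absolute values. -/
noncomputable def errBound (Abar : Matrix (Agent n) (Agent n) ℝ) (δ : Agent n → ℝ)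
    (x : ℕ → Profile n) (y : ℕ → Agent n → Profile n) : ℕ → Agent n → Agent n → ℝ
  | 0, q => fun p => |flat (x 0) q - flat (y 0 p) q|
  | t + 1, q => Atilde Abar δ q *ᵥ errBound Abar δ x y t q
      + fun _ => |flat (x (t + 1)) q - flat (x t) q|

lemma IsTrajectory.abs_sub_le_errBound {γ : Agent n → ℝ} (h : IsTrajectory J A Abar δ γ x y g)
    (hAbar : IsStronglyConnectedAdj Abar) (hrow : ∀ p, ∑ q, Abar p q = 1) (t : ℕ)
    (q p : Agent n) : |flat (x t) q - flat (y t p) q| ≤ errBound Abar δ x y t q p := by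
  induction t generalizing p with
  | zero => exact le_rfl
  | succ t ih =>
    set e : Agent n → ℝ := fun l => flat (x t) q - flat (y t l) q with he
    have h1 : flat (x (t + 1)) q - flat (y (t + 1) p) q
        = ∑ l, (Abar p l - if p = l then δ p * Abar p q else 0) * e l
          + (flat (x (t + 1)) q - flat (x t) q) := by
      have hx : ∑ l, Abar p l * flat (x t) q = flat (x t) q := by
        rw [← Finset.sum_mul, hrow, one_mul]
      simp only [h.estimate, he, sub_mul, mul_sub, ite_mul, zero_mul, Finset.sum_sub_distrib,
        Finset.sum_ite_eq, Finset.mem_univ, if_true, hx]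
      ring
    rw [h1]
    refine (abs_add_le _ _).trans (add_le_add_left ?_ _)
    refine (Finset.abs_sum_le_sum_abs _ _).trans (Finset.sum_le_sum fun l _ => ?_)
    rw [abs_mul]
    refine mul_le_mul (le_of_eq ?_) (ih l) (abs_nonneg _) (Atilde_nonneg hAbar q p l)
    by_cases hpl : p = l
    · subst hpl; simp [Atilde_self]
    · simp [Atilde_of_ne hpl, hpl, abs_of_nonneg (hAbar.nonneg p l)]

/-- Total size of the majorants of the estimation errors, in the given norm. -/
noncomputable def errBoundSq (P : NormPair (Agent n)) (Abar : Matrix (Agent n) (Agent n) ℝ)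
    (δ : Agent n → ℝ) (x : ℕ → Profile n) (y : ℕ → Agent n → Profile n) (t : ℕ) : ℝ :=
  ∑ q, P.vec (errBound Abar δ x y t q) ^ 2

lemma card_agent (n : Fin N → ℕ) : (Fintype.card (Agent n) : ℝ) = ∑ i, (n i : ℝ) := by
  simp [Agent]

lemma errBoundSq_succ_le {P : NormPair (Agent n)} {Cup σ ς : ℝ}
    (hup : ∀ v, P.vec v ≤ Cup * norm2 v) (hP : ∀ q, P.mat (Atilde Abar δ q) < 1)
    (hσ : ∀ q, sigmaAtilde Abar δ P q ≤ σ) (hς0 : 0 ≤ ς)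
    (hς : ∀ q, (1 + sigmaAtilde Abar δ P q ^ 2) / (1 - sigmaAtilde Abar δ P q ^ 2) ≤ ς) (t : ℕ) :
    errBoundSq P Abar δ x y (t + 1) ≤ (1 + σ ^ 2) / 2 * errBoundSq P Abar δ x y t
      + (∑ i, (n i : ℝ)) * ς * Cup ^ 2 * ∑ q, (flat (x (t + 1)) q - flat (x t) q) ^ 2 := by
  simp only [errBoundSq, Finset.mul_sum, ← Finset.sum_add_distrib]
  refine Finset.sum_le_sum fun q _ => ?_
  set d := flat (x (t + 1)) q - flat (x t) q with hd
  have hs0 : 0 ≤ sigmaAtilde Abar δ P q := apply_nonneg _ _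
  have hs1 : sigmaAtilde Abar δ P q < 1 := hP q
  have hconst : P.vec (fun _ => |d|) ^ 2 ≤ Cup ^ 2 * ((∑ i, (n i : ℝ)) * d ^ 2) := by
    refine (pow_le_pow_left₀ (apply_nonneg _ _) (hup _) 2).trans (le_of_eq ?_)
    rw [mul_pow, norm2_sq, Finset.sum_const, Finset.card_univ, nsmul_eq_mul, card_agent, sq_abs]
  have h1 : P.vec (errBound Abar δ x y (t + 1) q) ^ 2 ≤
      (1 + sigmaAtilde Abar δ P q ^ 2) / 2 * P.vec (errBound Abar δ x y t q) ^ 2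
        + (1 + sigmaAtilde Abar δ P q ^ 2) / (1 - sigmaAtilde Abar δ P q ^ 2)
          * P.vec (fun _ => |d|) ^ 2 := by
    refine sq_le_of_le_contraction_add (pow_lt_one₀ hs0 hs1 two_ne_zero) (apply_nonneg _ _) ?_
    exact (map_add_le_add P.vec _ _).trans (add_le_add_left (P.compatible _ _) _)
  refine h1.trans ?_
  have h2 := hσ q
  have h3 := hς q
  calc _ ≤ (1 + σ ^ 2) / 2 * P.vec (errBound Abar δ x y t q) ^ 2
        + ς * (Cup ^ 2 * ((∑ i, (n i : ℝ)) * d ^ 2)) := by gcongr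
    _ = _ := by ring

lemma IsTrajectory.estGap_le {γ : Agent n → ℝ} (h : IsTrajectory J A Abar δ γ x y g)
    (hAbar : IsStronglyConnectedAdj Abar) (hrow : ∀ p, ∑ q, Abar p q = 1)
    {P : NormPair (Agent n)} {Clo : ℝ} (hClo : 0 < Clo) (hlo : ∀ v, Clo * norm2 v ≤ P.vec v)
    (t : ℕ) : estGap (x t) (y t) ≤ errBoundSq P Abar δ x y t / Clo ^ 2 := by
  rw [le_div_iff₀ (pow_pos hClo 2), mul_comm]
  simp only [estGap, norm2_sq]
  rw [Finset.sum_comm, Finset.mul_sum, errBoundSq]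
  refine Finset.sum_le_sum fun q _ => ?_
  refine le_trans ?_ (pow_le_pow_left₀ (mul_nonneg hClo.le (norm2_nonneg _)) (hlo _) 2)
  rw [mul_pow, norm2_sq]
  refine mul_le_mul_of_nonneg_left (Finset.sum_le_sum fun p _ => ?_) (sq_nonneg _)
  rw [Pi.sub_apply, ← sq_abs, abs_sub_comm]
  exact pow_le_pow_left₀ (abs_nonneg _) (h.abs_sub_le_errBound hAbar hrow t q p) 2

lemma IsTrajectory.estError_le {γ : Agent n → ℝ} (h : IsTrajectory J A Abar δ γ x y g)
    (hAbar : IsStronglyConnectedAdj Abar) (hrow : ∀ p, ∑ q, Abar p q = 1)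
    {P : NormPair (Agent n)} {Clo Cup : ℝ} (hClo : 0 < Clo)
    (hlo : ∀ v, Clo * norm2 v ≤ P.vec v) (hup : ∀ v, P.vec v ≤ Cup * norm2 v) (t : ℕ) :
    estError P (x t) (y t) ≤ Cup ^ 2 * (errBoundSq P Abar δ x y t / Clo ^ 2) := by
  refine le_trans ?_ (mul_le_mul_of_nonneg_left (h.estGap_le hAbar hrow hClo hlo t) (sq_nonneg _))
  simp only [estGap, norm2_sq]
  rw [Finset.sum_comm, Finset.mul_sum, estError]
  refine Finset.sum_le_sum fun q _ => ?_
  refine (pow_le_pow_left₀ (apply_nonneg _ _) (hup _) 2).trans (le_of_eq ?_)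
  rw [mul_pow, norm2_sq]
  congr 1
  refine Finset.sum_congr rfl fun p _ => ?_
  rw [Pi.sub_apply, sub_sq_comm]

/-- The movement of the estimates is controlled by their errors before and after the step and by
the decision step. -/
lemma sum_estimate_move_le (x x' : Profile n) (y y' : Agent n → Profile n) :
    ∑ p, norm2 (flat (y' p) - flat (y p)) ^ 2 ≤
      3 * (estGap x' y' + estGap x y
        + (∑ i, (n i : ℝ)) * ∑ q, (flat x' q - flat x q) ^ 2) := by
  have h : ∀ p, norm2 (flat (y' p) - flat (y p)) ^ 2 ≤
      3 * (norm2 (flat (y' p) - flat x') ^ 2 + norm2 (flat (y p) - flat x) ^ 2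
        + ∑ q, (flat x' q - flat x q) ^ 2) := fun p => by
    simp only [norm2_sq, ← Finset.sum_add_distrib, Finset.mul_sum, Pi.sub_apply]
    refine Finset.sum_le_sum fun q _ => ?_
    nlinarith [sq_nonneg (flat (y' p) q - flat x' q + (flat (y p) q - flat x q)),
      sq_nonneg (flat (y' p) q - flat x' q - (flat x' q - flat x q)),
      sq_nonneg (flat (y p) q - flat x q + (flat x' q - flat x q))]
  refine (Finset.sum_le_sum fun p _ => h p).trans (le_of_eq ?_)
  rw [← Finset.mul_sum, Finset.sum_add_distrib, Finset.sum_add_distrib, Finset.sum_const,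
    Finset.card_univ, nsmul_eq_mul, card_agent, estGap, estGap]

/-! ### The scalars of a cluster game -/

section Scalars

variable {P : NormPair (Agent n)} {Clo Cup : ℝ}

lemma le_iSup_of_finite {α : Type*} [Finite α] (f : α → ℝ) (a : α) : f a ≤ ⨆ a, f a :=
  le_ciSup (Set.finite_range f).bddAbove a

lemma piMin_le (a : Agent n) : (params A Abar δ L χ P Clo Cup).piMin ≤ flat (bpi A) a :=
  ciInf_le (Set.finite_range _).bddBelow a

lemma le_piMax (a : Agent n) : flat (bpi A) a ≤ (params A Abar δ L χ P Clo Cup).piMax :=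
  le_iSup_of_finite (flat (bpi A)) a

lemma norm2_perronVec_le (i : Fin N) :
    norm2 (perronVec (A i)) ≤ (params A Abar δ L χ P Clo Cup).iota :=
  le_iSup_of_finite (fun i => norm2 (perronVec (A i))) i

lemma card_le (i : Fin N) : (n i : ℝ) ≤ (params A Abar δ L χ P Clo Cup).n :=
  Finset.single_le_sum (f := fun i => (n i : ℝ)) (fun _ _ => Nat.cast_nonneg _)
    (Finset.mem_univ i)

lemma flat_bpi_sq_le (a : Agent n) :
    flat (bpi A) a ^ 2 ≤ (params A Abar δ L χ P Clo Cup).n ^ 2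
      * (params A Abar δ L χ P Clo Cup).iota ^ 2 := by
  have h1 : (n a.1 : ℝ) ^ 2 ≤ (params A Abar δ L χ P Clo Cup).n ^ 2 :=
    pow_le_pow_left₀ (Nat.cast_nonneg _) (card_le a.1) 2
  have h2 : perronVec (A a.1) a.2 ^ 2 ≤ (params A Abar δ L χ P Clo Cup).iota ^ 2 := by
    refine le_trans ?_ (pow_le_pow_left₀ (norm2_nonneg _) (norm2_perronVec_le a.1) 2)
    rw [norm2_sq]
    exact Finset.single_le_sum (f := fun j => perronVec (A a.1) j ^ 2)
      (fun _ _ => sq_nonneg _) (Finset.mem_univ a.2)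
  calc flat (bpi A) a ^ 2 = (n a.1 : ℝ) ^ 2 * perronVec (A a.1) a.2 ^ 2 := mul_pow _ _ _
    _ ≤ _ := by gcongr

lemma one_le_div_of_sq_lt_one {σ : ℝ} (h : σ ^ 2 < 1) : 1 ≤ (1 + σ ^ 2) / (1 - σ ^ 2) := by
  rw [le_div_iff₀ (by linarith)]
  nlinarith [sq_nonneg σ]

namespace ClusterNetworks

lemma one_le_card (hA : ClusterNetworks A) (i : Fin N) : (1 : ℝ) ≤ n i := by
  exact_mod_cast hA.card_pos i

/-- The squared weights of a cluster sum to `n_i ^ 2 ‖π^i‖ ^ 2`. -/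
lemma sum_flat_bpi_sq_le (hA : ClusterNetworks A) :
    ∑ a, flat (bpi A) a ^ 2 ≤ (params A Abar δ L χ P Clo Cup).iota ^ 2
      * (params A Abar δ L χ P Clo Cup).cubes := by
  rw [Fintype.sum_sigma]
  change _ ≤ _ * ∑ i, (n i : ℝ) ^ 3
  rw [Finset.mul_sum]
  refine Finset.sum_le_sum fun i _ => ?_
  have h1 : norm2 (perronVec (A i)) ^ 2 ≤ (params A Abar δ L χ P Clo Cup).iota ^ 2 :=
    pow_le_pow_left₀ (norm2_nonneg _) (norm2_perronVec_le i) 2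
  have h2 : (n i : ℝ) ^ 2 ≤ (n i : ℝ) ^ 3 :=
    pow_le_pow_right₀ (hA.one_le_card i) (by norm_num)
  calc ∑ j, flat (bpi A) ⟨i, j⟩ ^ 2 = (n i : ℝ) ^ 2 * norm2 (perronVec (A i)) ^ 2 := by
        rw [norm2_sq, Finset.mul_sum]
        exact Finset.sum_congr rfl fun j _ => mul_pow _ _ _
    _ ≤ (n i : ℝ) ^ 3 * (params A Abar δ L χ P Clo Cup).iota ^ 2 := by gcongr
    _ = _ := mul_comm _ _

lemma piMin_pos (hA : ClusterNetworks A) [Nonempty (Agent n)] :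
    0 < (params A Abar δ L χ P Clo Cup).piMin := by
  obtain ⟨a, ha⟩ := exists_eq_ciInf_of_finite (f := flat (bpi A))
  exact (hA.bpi_pos a.1 a.2).trans_eq ha

lemma admissible (hA : ClusterNetworks A) (hN : 0 < N) (hχ : 0 < χ)
    (hP : ∀ q, P.mat (Atilde Abar δ q) < 1) (hClo : 0 < Clo)
    (hnorm : ∀ v, Clo * norm2 v ≤ P.vec v ∧ P.vec v ≤ Cup * norm2 v) :
    (params A Abar δ L χ P Clo Cup).Admissible := by
  have : Nonempty (Fin N) := Fin.pos_iff_nonempty.1 hN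
  obtain ⟨i₀⟩ := this
  have := hA.nonempty i₀
  obtain ⟨j₀⟩ := this
  let a₀ : Agent n := ⟨i₀, j₀⟩
  have : Nonempty (Fin N) := ⟨i₀⟩
  have : Nonempty (Agent n) := ⟨a₀⟩
  have hmin : 0 < (params A Abar δ L χ P Clo Cup).piMin := hA.piMin_pos
  have h1 : ∀ i, sigmaA A i ^ 2 < 1 := fun i =>
    pow_lt_one₀ (sigmaA_nonneg i) (hA.sigmaA_lt_one i) two_ne_zero
  have h2 : ∀ q, sigmaAtilde Abar δ P q ^ 2 < 1 := fun q =>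
    pow_lt_one₀ (apply_nonneg _ _) (hP q) two_ne_zero
  exact {
    n := (hA.one_le_card i₀).trans (card_le i₀)
    cubes := Finset.sum_pos (fun i _ => pow_pos (by exact_mod_cast hA.card_pos i) 3)
      ⟨i₀, Finset.mem_univ _⟩
    piMin := hmin
    piMax := (hA.bpi_pos i₀ j₀).trans_le (le_piMax a₀)
    iota := by
      refine lt_of_lt_of_le (Real.sqrt_pos.2 ?_) (norm2_perronVec_le i₀)
      exact Finset.sum_pos (fun j _ => pow_pos (hA.perronVec_pos i₀ j) 2) ⟨j₀, Finset.mem_univ _⟩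
    chi := hχ
    sigma1 := by
      obtain ⟨i, hi⟩ := exists_eq_ciSup_of_finite (f := sigmaA A)
      exact (congrArg (· ^ 2) hi).symm.trans_lt (h1 i)
    sigma2 := by
      obtain ⟨q, hq⟩ := exists_eq_ciSup_of_finite (f := sigmaAtilde Abar δ P)
      exact (congrArg (· ^ 2) hq).symm.trans_lt (h2 q)
    vs1 := (one_le_div_of_sq_lt_one (h1 i₀)).trans
      (le_iSup_of_finite (fun i => (1 + sigmaA A i ^ 2) / (1 - sigmaA A i ^ 2)) i₀)
    vs2 := (one_le_div_of_sq_lt_one (h2 a₀)).trans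
      (le_iSup_of_finite (fun q => (1 + sigmaAtilde Abar δ P q ^ 2)
        / (1 - sigmaAtilde Abar δ P q ^ 2)) a₀)
    Clo := hClo
    Clo_le_Cup := by
      have hpos : 0 < norm2 (fun _ : Agent n => (1 : ℝ)) := by
        refine Real.sqrt_pos.2 (Finset.sum_pos (fun _ _ => by norm_num) ⟨a₀, Finset.mem_univ _⟩)
      have h := hnorm fun _ => 1
      exact le_of_mul_le_mul_right (h.1.trans h.2) hpos }

end ClusterNetworks

end Scalars

/-! ### One iteration of the algorithm -/

section Iteration

variable {P : NormPair (Agent n)} {Clo Cup : ℝ}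

lemma neGap_nonneg (xs x : Profile n) : 0 ≤ neGap A xs x := sq_nonneg _

lemma trackError_nonneg (g : (i : Fin N) → Fin (n i) → Fin (n i) → ℝ) : 0 ≤ trackError A g :=
  Finset.sum_nonneg fun _ _ => Finset.sum_nonneg fun _ _ => sq_nonneg _

lemma estError_nonneg (P : NormPair (Agent n)) (x : Profile n) (y : Agent n → Profile n) :
    0 ≤ estError P x y :=
  Finset.sum_nonneg fun _ _ => sq_nonneg _

/-- Bound on the squared length of the search direction, which consists of the diagonal trackers. At
the equilibrium `xs` the pseudo-gradient vanishes, so it is bounded by the distance to `xs`. -/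
lemma ClusterNetworks.sum_tracker_diag_sq_le (hA : ClusterNetworks A) (hJ : CostAssumption J L)
    {γ : Agent n → ℝ} (hadm : (params A Abar δ L χ P Clo Cup).Admissible)
    (h : IsTrajectory J A Abar δ γ x y g)
    (hAbar : IsStronglyConnectedAdj Abar) (hrow : ∀ p, ∑ q, Abar p q = 1)
    (hlo : ∀ v, Clo * norm2 v ≤ P.vec v) {xs : Profile n} (hxs : ∀ i k, gameMap J xs i k = 0)
    (t : ℕ) :
    ∑ a : Agent n, g t a.1 a.2 a.2 ^ 2 ≤
      3 * ((params A Abar δ L χ P Clo Cup).stepGap * neGap A xs (x t)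
        + (params A Abar δ L χ P Clo Cup).piMax * trackError A (g t)
        + (params A Abar δ L χ P Clo Cup).stepEst * errBoundSq P Abar δ x y t) := by
  have hw : ∀ a, 0 < flat (bpi A) a := fun a => hA.bpi_pos a.1 a.2
  have hmax : ∀ a, flat (bpi A) a ≤ (params A Abar δ L χ P Clo Cup).piMax :=
    le_piMax
  have hsum : ∑ a, flat (bpi A) a ^ 2 ≤ (params A Abar δ L χ P Clo Cup).iota ^ 2
      * (params A Abar δ L χ P Clo Cup).cubes := hA.sum_flat_bpi_sq_le
  have hsq : ∀ a, flat (bpi A) a ^ 2 ≤ (params A Abar δ L χ P Clo Cup).n ^ 2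
      * (params A Abar δ L χ P Clo Cup).iota ^ 2 := flat_bpi_sq_le
  have hL : (params A Abar δ L χ P Clo Cup).L = L := rfl
  have hCl : (params A Abar δ L χ P Clo Cup).Clo = Clo := rfl
  generalize params A Abar δ L χ P Clo Cup = p at *
  have hF : ∀ a, flat (gameMap J (x t)) a ^ 2 ≤ L ^ 2 * ∑ b, (flat (x t) - flat xs) b ^ 2 := by
    intro a
    have h1 := hJ.abs_gameMap_sub_le hA.card_pos a.1 a.2 (x t) xs
    rw [hxs, sub_zero] at h1
    have h2 := pow_le_pow_left₀ (abs_nonneg _) h1 2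
    rwa [sq_abs, mul_pow, norm2_sq] at h2
  have hX : ∑ a, (flat (x t) - flat xs) a ^ 2 / flat (bpi A) a = neGap A xs (x t) :=
    (wnorm_sq hw _).symm
  have hG := sum_trackDev_sq_div_le hA.bpi_pos (g t)
  have hZ := (hJ.sum_gradErr_sq_le hA.card_pos (x t) (y t)).trans
    (mul_le_mul_of_nonneg_left (h.estGap_le hAbar hrow (hCl ▸ hadm.Clo) hlo t) (sq_nonneg L))
  have hM := hadm.piMax
  have e1 : p.piMax * L ^ 2 * (p.iota ^ 2 * p.cubes) = p.stepGap := by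
    rw [Params.stepGap, hL]; ring
  have e2 : p.n ^ 2 * p.iota ^ 2 * (L ^ 2 * (errBoundSq P Abar δ x y t / Clo ^ 2))
      = p.stepEst * errBoundSq P Abar δ x y t := by
    rw [Params.stepEst, hL, hCl]; ring
  simp only [hA.tracker_diag hJ h]
  refine (sum_direction_sq_le hw hmax hF hsum hsq).trans ?_
  rw [hX, e1, ← e2]
  gcongr

/-- The one-step inequalities hold along every run. -/
lemma ClusterNetworks.step (hA : ClusterNetworks A) (hJ : CostAssumption J L)
    (hF : StronglyMonotone J χ) (hadm : (params A Abar δ L χ P Clo Cup).Admissible)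
    (h : IsTrajectory J A Abar δ (fun _ => γ) x y g)
    (hAbar : IsStronglyConnectedAdj Abar) (hrow : ∀ p, ∑ q, Abar p q = 1)
    (hP : ∀ q, P.mat (Atilde Abar δ q) < 1)
    (hnorm : ∀ v, Clo * norm2 v ≤ P.vec v ∧ P.vec v ≤ Cup * norm2 v) (hγ : 0 < γ)
    {xs : Profile n} (hxs : ∀ i k, gameMap J xs i k = 0) (t : ℕ) :
    (params A Abar δ L χ P Clo Cup).Step γ (neGap A xs (x t)) (trackError A (g t))
      (errBoundSq P Abar δ x y t) (∑ q, (flat (x (t + 1)) q - flat (x t) q) ^ 2)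
      (neGap A xs (x (t + 1))) (trackError A (g (t + 1))) (errBoundSq P Abar δ x y (t + 1)) := by
  have hw : ∀ a, 0 < flat (bpi A) a := fun a => hA.bpi_pos a.1 a.2
  have hdir := hA.sum_tracker_diag_sq_le hJ hadm h hAbar hrow (fun v => (hnorm v).1) hxs t
  have hmin : ∀ a, (params A Abar δ L χ P Clo Cup).piMin ≤ flat (bpi A) a :=
    piMin_le
  have hmax : ∀ a, flat (bpi A) a ≤ (params A Abar δ L χ P Clo Cup).piMax :=
    le_piMax
  have hcard : ∀ i, (n i : ℝ) ≤ (params A Abar δ L χ P Clo Cup).n := card_le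
  have hς1 : ∀ i, (1 + sigmaA A i ^ 2) / (1 - sigmaA A i ^ 2)
      ≤ (params A Abar δ L χ P Clo Cup).vs1 :=
    le_iSup_of_finite fun i => (1 + sigmaA A i ^ 2) / (1 - sigmaA A i ^ 2)
  have hς2 : ∀ q, (1 + sigmaAtilde Abar δ P q ^ 2) / (1 - sigmaAtilde Abar δ P q ^ 2)
      ≤ (params A Abar δ L χ P Clo Cup).vs2 :=
    le_iSup_of_finite fun q => (1 + sigmaAtilde Abar δ P q ^ 2) / (1 - sigmaAtilde Abar δ P q ^ 2)
  have hσ1 : ∀ i, sigmaA A i ≤ (params A Abar δ L χ P Clo Cup).sigma1 :=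
    le_iSup_of_finite (sigmaA A)
  have hσ2 : ∀ q, sigmaAtilde Abar δ P q ≤ (params A Abar δ L χ P Clo Cup).sigma2 :=
    le_iSup_of_finite (sigmaAtilde Abar δ P)
  have hn : (params A Abar δ L χ P Clo Cup).n = ∑ i, (n i : ℝ) := rfl
  have hL : (params A Abar δ L χ P Clo Cup).L = L := rfl
  have hc : (params A Abar δ L χ P Clo Cup).chi = χ := rfl
  have hCl : (params A Abar δ L χ P Clo Cup).Clo = Clo := rfl
  have hCu : (params A Abar δ L χ P Clo Cup).Cup = Cup := rfl
  generalize params A Abar δ L χ P Clo Cup = p at *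
  have hest := h.estGap_le hAbar hrow (hCl ▸ hadm.Clo) (fun v => (hnorm v).1)
  have hn0 : 0 < p.n := one_pos.trans_le hadm.n
  have hm := hadm.piMin
  have hM := hadm.piMax
  have hχ := hadm.chi
  have hlo := hadm.Clo
  refine ⟨?_, ?_, ?_, ?_⟩
  · have : ∑ q, (flat (x (t + 1)) q - flat (x t) q) ^ 2
        = γ ^ 2 * ∑ a : Agent n, g t a.1 a.2 a.2 ^ 2 := by
      rw [Finset.mul_sum]
      refine Finset.sum_congr rfl fun a _ => ?_
      rw [flat, flat, h.action]
      ring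
    rw [this, mul_comm 3, mul_assoc]
    exact mul_le_mul_of_nonneg_left hdir (sq_nonneg γ)
  · have hmono : p.chi * ∑ a, (flat (x t) - flat xs) a ^ 2
        ≤ ∑ a, flat (gameMap J (x t)) a * (flat (x t) - flat xs) a := by
      have h1 := hF (x t) xs
      rw [norm2_sq] at h1
      simp only [hxs, sub_zero] at h1
      rw [hc, Fintype.sum_sigma (fun a => flat (gameMap J (x t)) a * _)]
      exact h1
    have h1 := sum_gradient_step_sq_div_le (w := flat (bpi A)) (h := gradErr J (x t) (y t))
      (e := trackDev A (g t)) hm hmin hmax hχ hγ hmono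
    have hX : ∑ a, (flat (x t) - flat xs) a ^ 2 / flat (bpi A) a = neGap A xs (x t) :=
      (wnorm_sq hw _).symm
    have hX' : neGap A xs (x (t + 1)) = ∑ a, ((flat (x t) - flat xs) a - γ *
        (flat (bpi A) a * flat (gameMap J (x t)) a + flat (bpi A) a * gradErr J (x t) (y t) a
          + trackDev A (g t) a)) ^ 2 / flat (bpi A) a := by
      rw [neGap, wnorm_sq hw]
      refine Finset.sum_congr rfl fun a _ => ?_
      rw [← hA.tracker_diag hJ h, Pi.sub_apply, Pi.sub_apply,
        show flat (x (t + 1)) a = flat (x t) a - γ * g t a.1 a.2 a.2 from h.action t a.1 a.2]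
      ring
    have hG := sum_trackDev_sq_div_le hA.bpi_pos (g t)
    have hZ : ∑ a, gradErr J (x t) (y t) a ^ 2
        ≤ p.n * (p.L ^ 2 * (errBoundSq P Abar δ x y t / p.Clo ^ 2)) := by
      refine (hJ.sum_gradErr_sq_le hA.card_pos (x t) (y t)).trans ?_
      rw [hL, hCl]
      have h2 := mul_le_mul_of_nonneg_left (hest t) (sq_nonneg L)
      refine h2.trans (le_mul_of_one_le_left ?_ hadm.n)
      exact le_trans (mul_nonneg (sq_nonneg L) (Finset.sum_nonneg fun _ _ => sq_nonneg _)) h2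
    simp only [← hA.tracker_diag hJ h, hX] at h1
    simp only [← hA.tracker_diag hJ h] at hX'
    rw [hX']
    refine h1.trans ?_
    calc _ ≤ (1 - γ * (p.piMin * p.chi)) * neGap A xs (x t)
          + γ * (3 / (p.piMin * p.chi)) * trackError A (g t)
          + γ * (3 * p.piMax / (p.piMin * p.chi))
            * (p.n * (p.L ^ 2 * (errBoundSq P Abar δ x y t / p.Clo ^ 2)))
          + γ ^ 2 / p.piMin * (3 * (p.stepGap * neGap A xs (x t) + p.piMax * trackError A (g t)
            + p.stepEst * errBoundSq P Abar δ x y t)) := by gcongr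
      _ = _ := by
        unfold Params.k1 Params.k2 Params.k4 Params.k5 Params.k6 Params.k7 Params.stepGap
          Params.stepEst
        field_simp
        ring
  · have h1 := hA.trackError_succ_le hJ h hσ1 (zero_le_one.trans hadm.vs1) hς1 hm
      (fun i j => hmin ⟨i, j⟩) hcard t
    have h2 := sum_estimate_move_le (x t) (x (t + 1)) (y t) (y (t + 1))
    rw [← hn] at h2
    have h3 := hest t
    have h4 := hest (t + 1)
    rw [← hCl] at h3 h4
    have hv := zero_le_one.trans hadm.vs1
    rw [← hL] at h1
    refine h1.trans ?_
    calc _ ≤ (1 + p.sigma1 ^ 2) / 2 * trackError A (g t) + p.vs1 * (p.n * p.L ^ 2 / p.piMin) *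
          (3 * (errBoundSq P Abar δ x y (t + 1) / p.Clo ^ 2 + errBoundSq P Abar δ x y t / p.Clo ^ 2
            + p.n * ∑ q, (flat (x (t + 1)) q - flat (x t) q) ^ 2)) := by
          gcongr
          refine h2.trans ?_
          gcongr
      _ = _ := by
        unfold Params.k10
        ring
  · have h1 := errBoundSq_succ_le (Abar := Abar) (δ := δ) (x := x) (y := y)
      (fun v => (hnorm v).2) hP hσ2 (zero_le_one.trans hadm.vs2) hς2 t
    rw [← hn, ← hCu] at h1
    refine h1.trans (le_of_eq ?_)
    unfold Params.k16
    ring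

end Iteration

end ClusterGame

open ClusterGame in
theorem corollary1 {N : ℕ} (hN : 0 < N) (n : Fin N → ℕ) (hn : ∀ i, 0 < n i)
    (J : LocalCosts n) (L χ : ℝ) (hχ : 0 < χ)
    (A : (i : Fin N) → Matrix (Fin (n i)) (Fin (n i)) ℝ)
    (Abar : Matrix (Agent n) (Agent n) ℝ) (δ : Agent n → ℝ)
    -- low-level networks: strongly connected, column stochastic
    (hA : ∀ i, IsStronglyConnectedAdj (A i)) (hAcol : ∀ i k, ∑ j, A i j k = 1)
    -- high-level network: strongly connected, row stochastic
    (hAbar : IsStronglyConnectedAdj Abar) (hAbarRow : ∀ p, ∑ q, Abar p q = 1)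
    -- local costs and game mapping
    (hJ : CostAssumption J L) (hF : StronglyMonotone J χ)
    -- parameters of the leader-following consensus
    (hδpos : ∀ p, 0 < δ p) (hδ : ∀ p q, δ p * Abar p q < 2 * Abar p p) :
    -- norms as required below exist
    (∃ P : NormPair (Agent n), ∀ q, P.mat (Atilde Abar δ q) < 1) ∧
    -- the Nash equilibrium exists and is unique, and the algorithm converges to it linearly
    ∃ xs : Profile n, (∀ z, IsNash J z ↔ z = xs) ∧
      ∀ (P : NormPair (Agent n)) (Clo Cup : ℝ),
        (∀ q, P.mat (Atilde Abar δ q) < 1) →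
        0 < Clo → 0 < Cup →
        (∀ v, Clo * norm2 v ≤ P.vec v ∧ P.vec v ≤ Cup * norm2 v) →
        ∀ γ : ℝ, 0 < γ →
          γ < min (1 / (params A Abar δ L χ P Clo Cup).k1)
            (min (params A Abar δ L χ P Clo Cup).gamma1
              (min (params A Abar δ L χ P Clo Cup).gamma2
                (params A Abar δ L χ P Clo Cup).gamma3)) →
          ∃ ρ : ℝ, 0 < ρ ∧ ρ < 1 ∧
            ∀ (x : ℕ → Profile n) (y : ℕ → Agent n → Profile n)
              (g : ℕ → (i : Fin N) → Fin (n i) → Fin (n i) → ℝ),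
              IsTrajectory J A Abar δ (fun _ => γ) x y g →
                TailSupLinear (fun t => neGap A xs (x t)) ρ ∧
                TailSupLinear (fun t => trackError A (g t)) ρ ∧
                TailSupLinear (fun t => estError P (x t) (y t)) ρ := by
  have hnet : ClusterNetworks A := ⟨hn, hA, hAcol⟩
  have : Nonempty (Agent n) := ⟨⟨⟨0, hN⟩, ⟨0, hn _⟩⟩⟩
  refine ⟨exists_normPair_Atilde hAbar hAbarRow hδpos hδ, ?_⟩
  obtain ⟨xs, hxs, hNash⟩ := exists_unique_nash hn hJ hχ hF
  refine ⟨xs, hNash, fun P Clo Cup hP hClo _ hnorm γ hγ hlt => ?_⟩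
  have hadm : (params A Abar δ L χ P Clo Cup).Admissible :=
    hnet.admissible hN hχ hP hClo hnorm
  obtain ⟨h1, hg1, -, hg3⟩ := by simpa only [lt_min_iff] using hlt
  obtain ⟨ρ, hρ0, hρ1, hrate⟩ := hadm.exists_rate hγ h1 hg1 hg3
  refine ⟨ρ, hρ0, hρ1, fun x y g h => ?_⟩
  obtain ⟨C, hdecay⟩ := hrate (fun t => neGap A xs (x t)) (fun t => trackError A (g t))
    (errBoundSq P Abar δ x y) _ (fun _ => neGap_nonneg _ _) (fun _ => trackError_nonneg _)
    (fun _ => Finset.sum_nonneg fun _ _ => sq_nonneg _)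
    (hnet.step hJ hF hadm h hAbar hAbarRow hP hnorm hγ hxs)
  refine ⟨tailSupLinear_of_le (fun _ => neGap_nonneg _ _) hρ0 hρ1 fun t => (hdecay t).1,
    tailSupLinear_of_le (fun _ => trackError_nonneg _) hρ0 hρ1 fun t => (hdecay t).2.1,
    tailSupLinear_of_le (C := Cup ^ 2 / Clo ^ 2 * C) (fun _ => estError_nonneg _ _ _) hρ0 hρ1
      fun t => ?_⟩
  calc estError P (x t) (y t) ≤ Cup ^ 2 * (errBoundSq P Abar δ x y t / Clo ^ 2) :=
        h.estError_le hAbar hAbarRow hClo (fun v => (hnorm v).1) (fun v => (hnorm v).2) t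
    _ = Cup ^ 2 / Clo ^ 2 * errBoundSq P Abar δ x y t := by ring
    _ ≤ Cup ^ 2 / Clo ^ 2 * (C * ρ ^ t) :=
        mul_le_mul_of_nonneg_left (hdecay t).2.2 (by positivity)
    _ = Cup ^ 2 / Clo ^ 2 * C * ρ ^ t := by ring
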